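/- Consider a full equality-join query $q$: $m\ge 1$ attributes, finitely many relations, each over a nonempty set of attributes, each attribute occurring in at least one relation; a database $D$ assigns to each relation $e$ a finite set $R_e$ of tuples of integers, and $q(D)$ is the natural join. *LFTJ* (LeapFrog TrieJoin) with an attribute order $o$ fixes the attributes one after the other in the order $o$; for each attribute it runs through the values common to all relations containing the attribute (restricted to the values fixed so far) by leapfrog join: as long as the current keys of the sorted trie iterators differ, an iterator with the least key seeks to the greatest key; after a common value, one iterator is moved to its next key. *ADOPT* with $n$ threads and step budget $b$ per episode works as follows. The cube spanned by the value ranges of all attributes is divided into $n$ equal shares along an attribute with the largest range; these are the initial unprocessed cubes. As long as there are unprocessed cubes, an episode is executed: a learning algorithm selects an attribute order $o$, and each thread, as long as its budget $b$ is not used up, retrieves some unprocessed cube $c=\prod_x[l_x,u_x]$ and runs LFTJ with order $o$ restricted to $c$. This is interrupted as soon as, after returning from the recursive call for a value of an attribute, the number of steps exceeds the remaining budget of the thread; the steps are then subtracted from the budget. If $v_x$ is the last value considered for attribute $x$ (with $v_x=u_x$ if all its values in $c$ have been considered), the cube $c$ is replaced by the nonempty ones among the $m$ cubes in which the first $i$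 attributes of $o$ are fixed to their values $v_x$, the next attribute $y$ ranges over $(v_y,u_y]$, and the later attributes range over all of $c$ ($0\le i<m$). A thread that finds no unprocessed cube may stay idle for the rest of the episode. The join phase is complete when no unprocessed cube is left. Time is the total number of elementary steps (of all threads together and of the main loop), not counting the preprocessing (unary filters, sorting). An operation of a trie iterator costs $1+\lfloor\log_2 M\rfloor$, where $M=\max_e|R_e|$ (binary search in a sorted relation); comparing keys, inserting results, managing cubes, computing rewards and the learning algorithm are charged by numbers that depend only on $q$ and $n$. **Theorem (ADOPT is worst-case optimal).** Let $q$ be a query, $n\ge 1$ a number of threads and $E\ge 1$ a bound on the number of episodes. There is a constant $C$, depending only on $q$, $n$, $E$, such that the following holds for all complete join phases of ADOPT with at most $E$ episodes, for every budget $b$ (which may depend on the data), every choice of attribute orders by the learning algorithm, every choice of retrieved cubes and every interleaving of the threads. 1. On every database, the time of ADOPT is at most $C$ times the time of LFTJ on the same database with one of the attribute orders that ADOPT has used. 2. On every database there is a budget $b$ for which ADOPT has a complete join phase with at most $E$ episodes. 3. Let $N_e\ge 1$ for each relation $e$. Over the databases with $|R_e|\le N_e$ for all $e$, the worst-case time of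 ADOPT and the worst-case time of LFTJ, for each attribute order, agree up to the factor $C$: the maximum over these databases of the slowest such join phase of ADOPT is at most $C$ times the worst-case time of LFTJ, and the latter is at most $C$ times the maximum over these databases of the fastest such join phase of ADOPT. 4. With $N_e$ as before, on every database with $|R_e|\le N_e$ for all $e$, the time of ADOPT is at most $C\cdot Q^*\cdot(1+\lfloor\log_2\max_e N_e\rfloor)$, where $Q^*$ is the maximum of $|q(D')|$ over all databases $D'$ with $|R'_e|\le N_e$ for all $e$. That is, ADOPT is worst-case optimal (up to the logarithmic factor of LFTJ). -/

import Mathlib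

namespace Adopt

/-! ### Equality-join queries and databases -/

/-- A full equality-join (natural join) query.  An attribute is a class of columns that are linked by
equality conditions; relation `e` has exactly one column for each attribute in `attrs e`. -/
structure JoinQuery where
  numAttr : ℕ
  numRel : ℕ
  attrs : Fin numRel → Finset (Fin numAttr)
  numAttr_pos : 0 < numAttr
  attrs_nonempty : ∀ e, (attrs e).Nonempty
  covered : ∀ x, ∃ e, x ∈ attrs e

/-- A database instance: relation `e` is a finite set of integer tuples indexed by `attrs e`. -/
abbrev Instance (q : JoinQuery) : Type :=
  (e : Fin q.numRel) → Finset ((x : Fin q.numAttr) → x ∈ q.attrs e → ℤ)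

/-- A global attribute order: position `i` carries attribute `o i`. -/
abbrev AttrOrder (q : JoinQuery) : Type := Equiv.Perm (Fin q.numAttr)

/-- Partial assignments of values to attributes. -/
abbrev Assignment (q : JoinQuery) : Type := Fin q.numAttr → Option ℤ

/-- The result of the query on the instance `D`. -/
def joinResult (q : JoinQuery) (D : Instance q) : Set (Fin q.numAttr → ℤ) :=
  {t | ∀ e, (fun x _ => t x) ∈ D e}

/-- Every relation `e` of `D` has at most `N e` tuples. -/
def SizeAtMost (q : JoinQuery) (N : Fin q.numRel → ℕ) (D : Instance q) : Prop :=
  ∀ e, (D e).card ≤ N e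

/-- The largest result of the query on a database with relation sizes at most `N`. -/
noncomputable def worstCaseOutput (q : JoinQuery) (N : Fin q.numRel → ℕ) : ℕ∞ :=
  ⨆ (D : Instance q) (_ : SizeAtMost q N D), (joinResult q D).encard

/-- The factor `1 + ⌊log₂ M⌋`, where `M` is the largest of the given relation sizes. -/
def logFactor (q : JoinQuery) (N : Fin q.numRel → ℕ) : ℕ :=
  1 + Nat.log 2 (Finset.univ.sup N)

/-- The cost of one trie-iterator operation (binary search in a sorted relation of `D`). -/
def opCost (q : JoinQuery) (D : Instance q) : ℕ := logFactor q fun e => (D e).card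

/-! ### Leapfrog join -/

/-- What a leapfrog join does, in order of time: moving one iterator (`seek` or `next`), or
producing the next common value. -/
inductive LeapfrogEvent where
  | move : LeapfrogEvent
  | value (v : ℤ) : LeapfrogEvent

/-- `seek(hi)` on the first iterator whose current key is `lo`.  An iterator is represented by the
sorted list of the keys from its current position on; the empty list is the end of the list. -/
def seekLeast (lo hi : ℤ) : List (List ℤ) → List (List ℤ)
  | [] => []
  | it :: its =>
    if it.head? = some lo then it.dropWhile (fun w => decide (w < hi)) :: its
    else it :: seekLeast lo hi its

/-- `next()` on the first iterator. -/
def nextFirst : List (List ℤ) → List (List ℤ)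
  | [] => []
  | it :: its => it.tail :: its

theorem sum_length_seekLeast_lt {lo hi : ℤ} (h : lo < hi) :
    ∀ {its : List (List ℤ)}, lo ∈ its.filterMap List.head? →
      ((seekLeast lo hi its).map List.length).sum < (its.map List.length).sum
  | [], hm => by simp at hm
  | it :: its, hm => by
    unfold seekLeast
    split_ifs with hh
    · cases it with
      | nil => simp at hh
      | cons a as =>
        have ha : a = lo := by simpa using hh
        subst ha
        have h1 : (as.dropWhile fun w => decide (w < hi)).length ≤ as.length :=
          (List.dropWhile_sublist _).length_le
        simp [h]
        omega
    · have hm' : lo ∈ its.filterMap List.head? := by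
        cases it with
        | nil => simpa using hm
        | cons a as =>
          have hne : ¬ a = lo := by simpa using hh
          rw [List.filterMap_cons] at hm
          simp only [List.head?_cons, List.mem_cons] at hm
          rcases hm with hm | hm
          · exact absurd hm.symm hne
          · exact hm
      have := sum_length_seekLeast_lt h hm'
      simp
      exact this

theorem sum_length_nextFirst_lt {its : List (List ℤ)} (h1 : its ≠ []) (h2 : ¬ [] ∈ its) :
    ((nextFirst its).map List.length).sum < (its.map List.length).sum := by
  cases its with
  | nil => exact absurd rfl h1
  | cons it its =>
    cases it with
    | nil => simp at h2
    | cons a as => simp [nextFirst]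

/-- Leapfrog join of the iterators `its`, up to the upper bound `u`.  With `lo` and `hi` the least and
the greatest current key: if they agree, the common value is produced and one iterator is moved on
by `next`; otherwise one of the iterators with the least key performs `seek(hi)`.  The join ends when an
iterator is at its end or a key exceeds `u`. -/
def leapfrog (u : ℤ) (its : List (List ℤ)) : List LeapfrogEvent :=
  if _hEnd : [] ∈ its then []
  else
    match hlo : (its.filterMap List.head?).min?, (its.filterMap List.head?).max? with
    | some lo, some hi =>
      if u < hi then []
      else if _hlt : lo < hi then .move :: leapfrog u (seekLeast lo hi its)
      else .value hi :: .move :: leapfrog u (nextFirst its)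
    | _, _ => []
termination_by (its.map List.length).sum
decreasing_by
  · exact sum_length_seekLeast_lt _hlt (List.min?_mem hlo)
  · refine sum_length_nextFirst_lt ?_ _hEnd
    rintro rfl
    simp at hlo

/-! ### Triejoin of one cube, with timeout -/

/-- A hypercube in the space of attribute values: the product of the intervals `[lo x, hi x]`. -/
structure Cube (m : ℕ) where
  lo : Fin m → ℤ
  hi : Fin m → ℤ

/-- The cube contains at least one point. -/
def Cube.IsNonempty {m : ℕ} (c : Cube m) : Prop := ∀ x, c.lo x ≤ c.hi x

instance {m : ℕ} (c : Cube m) : Decidable c.IsNonempty :=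
  inferInstanceAs (Decidable (∀ x, c.lo x ≤ c.hi x))

/-- The relations that contain the attribute `x`. -/
def relationsWith (q : JoinQuery) (x : Fin q.numAttr) : List {e : Fin q.numRel // x ∈ q.attrs e} :=
  (List.finRange q.numRel).filterMap fun e => if h : x ∈ q.attrs e then some ⟨e, h⟩ else none

/-- The trie level of relation `e` for attribute `x` under the node given by `M`: the sorted list of the
distinct `x`-values of those tuples of `e` that agree with all values fixed by `M`. -/
def trieLevel (q : JoinQuery) (D : Instance q) (M : Assignment q) (x : Fin q.numAttr)
    (e : {e : Fin q.numRel // x ∈ q.attrs e}) : List ℤ :=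
  (((D e.1).filter fun t => ∀ y, ∀ h : y ∈ q.attrs e.1, M y = none ∨ M y = some (t y h)).image
    fun t => t x e.2).sort (· ≤ ·)

/-- Outcome of a (possibly interrupted) triejoin: the inserted tuples, the value of the step counter,
and for each attribute the last value considered.  If all values of an attribute in the cube have been
considered, then the last value considered is the upper bound of the cube. -/
structure JoinOutcome (q : JoinQuery) where
  inserted : List (Assignment q)
  steps : ℕ
  last : Fin q.numAttr → ℤ

/-- The loop over the values of attribute `x`.  It follows the leapfrog events lazily: each move costs
`w` steps, each value `v` triggers `child v`, after which the loop is left if the step counter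
exceeds the budget `b`. -/
def scan {q : JoinQuery} (b : ℕ∞) (c : Cube q.numAttr) (x : Fin q.numAttr) (w : ℕ)
    (child : ℤ → ℕ → JoinOutcome q) : List LeapfrogEvent → ℕ → JoinOutcome q
  | [], s => ⟨[], s, c.hi⟩
  | .move :: es, s => scan b c x w child es (s + w)
  | .value v :: es, s =>
    let r := child v s
    if b < (r.steps : ℕ∞) then ⟨r.inserted, r.steps, Function.update r.last x v⟩
    else
      let r' := scan b c x w child es r.steps
      ⟨r.inserted ++ r'.inserted, r'.steps, r'.last⟩

/-- Recursive triejoin over the remaining attributes, restricted to the cube `c`, with budget `b`.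
Arguments: remaining attributes, values fixed so far, step counter.  Entering a level performs
`open`, the `seek` to the lower bound of the cube and (on leaving) `up` on every relation with the current
attribute; each leapfrog move costs one iterator operation and one look at all current keys;
inserting a result tuple costs one step per attribute. -/
def joinRec (q : JoinQuery) (D : Instance q) (b : ℕ∞) (c : Cube q.numAttr) :
    List (Fin q.numAttr) → Assignment q → ℕ → JoinOutcome q
  | [], M, s => ⟨[M], s + q.numAttr, c.hi⟩
  | x :: xs, M, s =>
    let rels := relationsWith q x
    let its := rels.map fun e => (trieLevel q D M x e).dropWhile fun w => decide (w < c.lo x)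
    scan b c x (opCost q D + rels.length)
      (fun v s' => joinRec q D b c xs (Function.update M x (some v)) s')
      (leapfrog (c.hi x) its) (s + 3 * rels.length * opCost q D)

/-- The anytime triejoin of the cube `c` with attribute order `o` and budget `b`. -/
def joinOneCube (q : JoinQuery) (D : Instance q) (b : ℕ∞) (o : AttrOrder q)
    (c : Cube q.numAttr) : JoinOutcome q :=
  joinRec q D b c (List.ofFn o) (fun _ => none) 0

/-- The values of attribute `x` that occur in the database. -/
def attrValues (q : JoinQuery) (D : Instance q) (x : Fin q.numAttr) : Finset ℤ :=
  (relationsWith q x).toFinset.biUnion fun e => (D e.1).image fun t => t x e.2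

/-- The cube spanned by the value ranges of all attributes (`[0, 0]` for an attribute without any
value). -/
def queryCube (q : JoinQuery) (D : Instance q) : Cube q.numAttr where
  lo x := if h : (attrValues q D x).Nonempty then (attrValues q D x).min' h else 0
  hi x := if h : (attrValues q D x).Nonempty then (attrValues q D x).max' h else 0

/-- Running time of LeapFrog TrieJoin with attribute order `o`: the triejoin of the whole query cube
without a limit on the number of steps. -/
def lftjTime (q : JoinQuery) (D : Instance q) (o : AttrOrder q) : ℕ :=
  (joinOneCube q D ⊤ o (queryCube q D)).steps

/-- Worst-case running time of LeapFrog TrieJoin with order `o` on relation sizes at most `N`. -/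
noncomputable def lftjWorstTime (q : JoinQuery) (N : Fin q.numRel → ℕ) (o : AttrOrder q) : ℕ∞ :=
  ⨆ (D : Instance q) (_ : SizeAtMost q N D), (lftjTime q D o : ℕ∞)

/-! ### The task manager -/

/-- The cube `f × [l + ⌊i w / n⌋, l + ⌊(i + 1) w / n⌋ - 1]`: the `i`-th of `n` equal shares of `c`, along
the dimension `a`, where `[l, l + w - 1]` is the range of `c` in this dimension. -/
def Cube.share {m : ℕ} (c : Cube m) (a : Fin m) (n i : ℕ) : Cube m where
  lo := Function.update c.lo a (c.lo a + i * (c.hi a - c.lo a + 1) / n)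
  hi := Function.update c.hi a (c.lo a + (i + 1) * (c.hi a - c.lo a + 1) / n - 1)

/-- The initial unprocessed cubes, one for each of the `n` threads (empty ones are left out). -/
def initialCubes {m : ℕ} (c : Cube m) (a : Fin m) (n : ℕ) : List (Cube m) :=
  ((List.range n).map (c.share a n)).filter fun c' => decide c'.IsNonempty

/-- The unprocessed cube for position `i` of the order `o`, if the target cube `c` was processed up to the
values `v`: attributes before position `i` are fixed to their value in `v`, the attribute at position
`i` ranges over `(v, c.hi]`, and the later attributes range over all of `c`. -/
def remainderAt {m : ℕ} (o : Equiv.Perm (Fin m)) (c : Cube m) (v : Fin m → ℤ) (i : Fin m) :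
    Cube m where
  lo x := if o.symm x < i then v x else if o.symm x = i then v x + 1 else c.lo x
  hi x := if o.symm x < i then v x else c.hi x

/-- The unprocessed cubes that replace a target cube `c` processed up to the values `v`. -/
def remainder {m : ℕ} (o : Equiv.Perm (Fin m)) (c : Cube m) (v : Fin m → ℤ) : List (Cube m) :=
  ((List.finRange m).map (remainderAt o c v)).filter fun c' => decide c'.IsNonempty

/-! ### ADOPT -/

/-- Global state of the join phase: the unprocessed cubes that no thread works on, the result set, and
the number of steps spent so far by all threads and by the main loop together. -/
structure SystemState (q : JoinQuery) where
  unprocessed : Multiset (Cube q.numAttr)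
  results : Set (Assignment q)
  time : ℕ

/-- State during an episode: remaining budget and current target cube (if any) of each thread. -/
structure EpisodeState (q : JoinQuery) (n : ℕ) where
  sys : SystemState q
  budget : Fin n → ℕ
  target : Fin n → Option (Cube q.numAttr)

/-- Steps of the parallel worker threads in an episode with attribute order `o`.  Threads
interleave arbitrarily, and any unprocessed cube may be the one that is retrieved. -/
inductive ThreadStep (q : JoinQuery) (D : Instance q) (o : AttrOrder q) (n : ℕ) :
    EpisodeState q n → EpisodeState q n → Prop
  /-- A thread with budget left retrieves an unprocessed cube (one step per attribute). -/
  | retrieve (σ : EpisodeState q n) (t : Fin n) (c : Cube q.numAttr)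
      (U : Multiset (Cube q.numAttr)) (hbudget : 0 < σ.budget t) (hfree : σ.target t = none)
      (hc : σ.sys.unprocessed = c ::ₘ U) :
      ThreadStep q D o n σ
        { sys := { σ.sys with unprocessed := U, time := σ.sys.time + q.numAttr }
          budget := σ.budget
          target := Function.update σ.target t (some c) }
  /-- A thread joins its target cube until it is done or its budget is exceeded, inserts the results,
  and hands the remainder back to the task manager.  Besides the join steps, computing the processed
  cubes, their volumes (the reward) and the remaining cubes each takes one step for each pair of a
  cube and an attribute. -/
  | join (σ : EpisodeState q n) (t : Fin n) (c : Cube q.numAttr) (r : JoinOutcome q)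
      (hc : σ.target t = some c) (hr : r = joinOneCube q D (σ.budget t : ℕ∞) o c) :
      ThreadStep q D o n σ
        { sys :=
            { unprocessed := σ.sys.unprocessed + (remainder o c r.last : Multiset (Cube q.numAttr))
              results := σ.sys.results ∪ {M | M ∈ r.inserted}
              time := σ.sys.time + r.steps + 3 * q.numAttr ^ 2 }
          budget := Function.update σ.budget t (σ.budget t - r.steps)
          target := Function.update σ.target t none }
  /-- A thread with budget left that finds no unprocessed cube may stay idle for the rest of the episode. -/
  | idle (σ : EpisodeState q n) (t : Fin n) (hbudget : 0 < σ.budget t) (hfree : σ.target t = none)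
      (hU : σ.sys.unprocessed = 0) :
      ThreadStep q D o n σ
        { sys := { σ.sys with time := σ.sys.time + 1 }
          budget := Function.update σ.budget t 0
          target := σ.target }

/-- One iteration of the main loop with attribute order `o`, per-episode budget `b` and `n` threads.
Choosing the order by reinforcement learning (at most `m` children compared on each of `m` tree
levels, for `m` attributes) and updating the statistics along the path costs `m ^ 2 + m` steps. -/
def Episode (q : JoinQuery) (D : Instance q) (n b : ℕ) (o : AttrOrder q)
    (σ τ : SystemState q) : Prop :=
  ∃ ρ : EpisodeState q n,
    Relation.ReflTransGen (ThreadStep q D o n)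
      { sys := { σ with time := σ.time + q.numAttr ^ 2 + q.numAttr }
        budget := fun _ => b
        target := fun _ => none } ρ ∧
    (∀ t, ρ.budget t = 0) ∧ (∀ t, ρ.target t = none) ∧ τ = ρ.sys

/-- `Run q D n b os σ`: starting from the initial cubes, ADOPT with `n` threads and per-episode budget
`b` can reach the state `σ` by episodes with the attribute orders `os`.  The orders selected by the
learning algorithm are arbitrary. -/
inductive Run (q : JoinQuery) (D : Instance q) (n b : ℕ) :
    List (AttrOrder q) → SystemState q → Prop
  /-- The query cube is divided along an attribute `a` with the largest value range. -/
  | init (a : Fin q.numAttr)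
      (ha : ∀ x, (queryCube q D).hi x - (queryCube q D).lo x ≤
        (queryCube q D).hi a - (queryCube q D).lo a) :
      Run q D n b []
        { unprocessed := (initialCubes (queryCube q D) a n : Multiset (Cube q.numAttr))
          results := ∅
          time := n * q.numAttr }
  /-- As long as there are unprocessed cubes, another episode follows. -/
  | episode (os : List (AttrOrder q)) (σ τ : SystemState q) (o : AttrOrder q)
      (hrun : Run q D n b os σ) (hU : σ.unprocessed ≠ 0) (hep : Episode q D n b o σ τ) :
      Run q D n b (os ++ [o]) τ

/-- ADOPT with `n` threads has a complete join phase on `D`, of total time `time`, with the sequence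
`os` of attribute orders (one for each episode), for some per-episode budget. -/
def Completes (q : JoinQuery) (D : Instance q) (n : ℕ) (os : List (AttrOrder q)) (time : ℕ) :
    Prop :=
  ∃ (b : ℕ) (σ : SystemState q), Run q D n b os σ ∧ σ.unprocessed = 0 ∧ σ.time = time

/-- The time of the slowest complete join phase of ADOPT on `D` with at most `E` episodes. -/
noncomputable def adoptSlowest (q : JoinQuery) (D : Instance q) (n E : ℕ) : ℕ∞ :=
  ⨆ (os : List (AttrOrder q)) (time : ℕ) (_ : Completes q D n os time ∧ os.length ≤ E),
    (time : ℕ∞)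

/-- The time of the fastest complete join phase of ADOPT on `D` with at most `E` episodes. -/
noncomputable def adoptFastest (q : JoinQuery) (D : Instance q) (n E : ℕ) : ℕ∞ :=
  ⨅ (os : List (AttrOrder q)) (time : ℕ) (_ : Completes q D n os time ∧ os.length ≤ E),
    (time : ℕ∞)

/-- Worst case of `adoptSlowest` on relation sizes at most `N`. -/
noncomputable def adoptWorstTime (q : JoinQuery) (N : Fin q.numRel → ℕ) (n E : ℕ) : ℕ∞ :=
  ⨆ (D : Instance q) (_ : SizeAtMost q N D), adoptSlowest q D n E

/-- Worst case of `adoptFastest` on relation sizes at most `N`. -/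
noncomputable def adoptWorstFastestTime (q : JoinQuery) (N : Fin q.numRel → ℕ) (n E : ℕ) : ℕ∞ :=
  ⨆ (D : Instance q) (_ : SizeAtMost q N D), adoptFastest q D n E

end Adopt

open Adopt

namespace Adopt

/-! Upper bound against LFTJ. A thread whose join is interrupted has no budget left, so each thread
suffers at most one timeout per episode. A timeout leaves at most `m` cubes, and a join that reaches
the end of its cube leaves none. Hence at most `n + E * n * m` joins take place, and a potential
function (`ThreadStep.potential_le`) bounds the total time by the cost of these joins plus overhead.
It remains to compare the triejoin of one cube with that of the whole query cube for the same order
(`triejoinCost_le_queryCube`).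

This comparison is not plain monotonicity: after the seek to the lower bound of a cube, a leapfrog
join can visit quite different keys from the unrestricted one. The remedy is a certificate that does
not mention the choices of the join. `Paced its θ j` says that `j` jumps over gaps of single
iterators, or over single keys, lead from `θ` past the end of some iterator. A complete leapfrog
join with `M` moves yields a certificate of length `2 * M` (`paced_of_leapfrog`); a certificate
survives the removal of keys (`Paced.mono`); and a certificate of length `j` bounds every leapfrog
join of `k` iterators that starts with some key at or above `θ` by `(k + 1) * (j + 1)` moves
(`Paced.moveCount_le`).

Worst-case optimality of LFTJ. A node with next attribute `y` costs a constant number of iterator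
operations for each key in the shortest trie level for `y`, plus a constant number. The sum of these
shortest lengths over all nodes of one depth is at most `Q*`, without any explicit formula for `Q*`:
keep the values of the attributes fixed so far, replace each `y`-value by its rank in its trie
level, and set all other values to zero. No relation grows beyond its bound, and each pair of a node
and a rank below the shortest length becomes a result tuple of its own
(`extendNode_mem_joinResult`).

Lower bounds. LFTJ and ADOPT both insert every result tuple, and each insertion is paid for by an
iterator operation; for ADOPT this rests on the invariant that no result point is lost when a cube
is replaced by its remainder (`ThreadStep.covering`). Padding the relations to their full sizes
makes the logarithmic factor as large as allowed while keeping the result (`exists_enlarged`). So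
both worst cases lie between `Q*` times the logarithmic factor and a constant multiple of it. -/

/-! ### Leapfrog join: values and number of moves -/

/-- The number of iterator moves among the events. -/
def moveCount : List LeapfrogEvent → ℕ
  | [] => 0
  | .move :: es => moveCount es + 1
  | .value _ :: es => moveCount es

/-- The values produced by the events. -/
def eventValues : List LeapfrogEvent → List ℤ
  | [] => []
  | .move :: es => eventValues es
  | .value v :: es => v :: eventValues es

/-- Every value is followed by a move. -/
inductive ValuesFollowedByMove : List LeapfrogEvent → Prop
  | nil : ValuesFollowedByMove []
  | move {es} : ValuesFollowedByMove es → ValuesFollowedByMove (.move :: es)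
  | value {v es} : ValuesFollowedByMove es → ValuesFollowedByMove (.value v :: .move :: es)

/-- All lists in `its` are strictly increasing. -/
def AllIncreasing (its : List (List ℤ)) : Prop := ∀ it ∈ its, it.Pairwise (· < ·)

theorem seekLeast_eq {lo hi : ℤ} : ∀ {its : List (List ℤ)}, (∃ as, lo :: as ∈ its) → lo < hi →
    ∃ pre as post, its = pre ++ (lo :: as) :: post ∧
      seekLeast lo hi its = pre ++ (as.dropWhile fun w => decide (w < hi)) :: post
  | [], h, _ => by simp at h
  | it :: its, h, hlt => by
    unfold seekLeast
    split_ifs with hh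
    · cases it with
      | nil => simp at hh
      | cons a as =>
        obtain rfl : a = lo := by simpa using hh
        exact ⟨[], as, its, rfl, by simp [hlt]⟩
    · obtain ⟨as, has⟩ := h
      have has' : lo :: as ∈ its := by
        rcases List.mem_cons.1 has with h | h
        · subst h; simp at hh
        · exact h
      obtain ⟨pre, as', post, h1, h2⟩ := seekLeast_eq ⟨as, has'⟩ hlt
      exact ⟨it :: pre, as', post, by simp [h1], by simp [h2]⟩

theorem leapfrog_of_nil_mem {u : ℤ} {its : List (List ℤ)} (h : [] ∈ its) :
    leapfrog u its = [] := by
  rw [leapfrog]; simp [h]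

theorem leapfrog_nil (u : ℤ) : leapfrog u [] = [] := by
  rw [leapfrog]; simp

/-- The least and the greatest current key of a family of iterators. -/
theorem exists_heads {its : List (List ℤ)} (h0 : [] ∉ its) (h1 : its ≠ []) :
    ∃ lo hi, (its.filterMap List.head?).min? = some lo ∧
      (its.filterMap List.head?).max? = some hi ∧
      (∀ it ∈ its, ∃ a as, it = a :: as ∧ lo ≤ a ∧ a ≤ hi) ∧
      (∃ as, lo :: as ∈ its) ∧ ∃ as, hi :: as ∈ its := by
  have hne : its.filterMap List.head? ≠ [] := by
    obtain ⟨it, its', rfl⟩ := List.exists_cons_of_ne_nil h1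
    cases it with
    | nil => simp at h0
    | cons a as => simp
  have hmem : ∀ a, a ∈ its.filterMap List.head? ↔ ∃ as, a :: as ∈ its := by
    intro a
    rw [List.mem_filterMap]
    constructor
    · rintro ⟨it, hit, ha⟩
      cases it with
      | nil => simp at ha
      | cons b bs =>
        obtain rfl : b = a := by simpa using ha
        exact ⟨bs, hit⟩
    · rintro ⟨as, has⟩
      exact ⟨_, has, rfl⟩
  obtain ⟨lo, hlo⟩ := Option.ne_none_iff_exists'.1 (mt List.min?_eq_none_iff.1 hne)
  obtain ⟨hi, hhi⟩ := Option.ne_none_iff_exists'.1 (mt List.max?_eq_none_iff.1 hne)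
  refine ⟨lo, hi, hlo, hhi, ?_, (hmem _).1 (List.min?_mem hlo), (hmem _).1 (List.max?_mem hhi)⟩
  intro it hit
  cases it with
  | nil => exact absurd hit h0
  | cons a as =>
    have ha := (hmem a).2 ⟨as, hit⟩
    exact ⟨a, as, rfl, (List.min?_eq_some_iff.1 hlo).2 a ha, (List.max?_eq_some_iff.1 hhi).2 a ha⟩

/-- Induction along the run of a leapfrog join. -/
theorem leapfrog_induction {u : ℤ} {motive : List (List ℤ) → Prop}
    (nil : motive [])
    (atEnd : ∀ its, [] ∈ its → motive its)
    (exceeded : ∀ its hi as, leapfrog u its = [] → hi :: as ∈ its → u < hi → motive its)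
    (seek : ∀ pre lo as post hi,
      (∀ it ∈ pre ++ (lo :: as) :: post, ∃ a bs, it = a :: bs ∧ lo ≤ a ∧ a ≤ hi) →
      (∃ bs, hi :: bs ∈ pre ++ post) → lo < hi → hi ≤ u →
      leapfrog u (pre ++ (lo :: as) :: post) =
        .move :: leapfrog u (pre ++ (as.dropWhile fun w => decide (w < hi)) :: post) →
      motive (pre ++ (as.dropWhile fun w => decide (w < hi)) :: post) →
      motive (pre ++ (lo :: as) :: post))
    (value : ∀ hi as rest, (∀ it ∈ rest, ∃ bs, it = hi :: bs) → hi ≤ u →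
      leapfrog u ((hi :: as) :: rest) = .value hi :: .move :: leapfrog u (as :: rest) →
      motive (as :: rest) → motive ((hi :: as) :: rest))
    (its : List (List ℤ)) : motive its := by
  induction hN : (its.map List.length).sum using Nat.strong_induction_on generalizing its with
  | _ N ih =>
  by_cases h0 : [] ∈ its
  · exact atEnd its h0
  by_cases h1 : its = []
  · subst h1; exact nil
  obtain ⟨lo, hi, hlo, hhi, hb, ⟨as, hlom⟩, ⟨bs, hhim⟩⟩ := exists_heads h0 h1
  have hunf : leapfrog u its = if u < hi then [] else if lo < hi then
      .move :: leapfrog u (seekLeast lo hi its)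
      else .value hi :: .move :: leapfrog u (nextFirst its) := by
    rw [leapfrog, dif_neg h0]
    split
    · rename_i lo' hi' h1 h2
      obtain rfl : lo = lo' := by simpa [hlo] using h1
      obtain rfl : hi = hi' := by simpa [hhi] using h2
      simp only [dite_eq_ite]
    · rename_i h; exact absurd hhi (h lo hi hlo)
  by_cases hu : u < hi
  · exact exceeded its hi bs (by rw [hunf, if_pos hu]) hhim hu
  rw [if_neg hu] at hunf
  by_cases hlt : lo < hi
  · have hdec := sum_length_seekLeast_lt hlt (List.min?_mem hlo)
    rw [if_pos hlt] at hunf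
    obtain ⟨pre, as', post, h1, h2⟩ := seekLeast_eq ⟨as, hlom⟩ hlt
    rw [h2] at hunf hdec
    have := ih _ (hN ▸ hdec) _ rfl
    subst h1
    refine seek pre lo as' post hi hb ⟨bs, ?_⟩ hlt (not_lt.1 hu) hunf this
    simp only [List.mem_append, List.mem_cons, List.cons.injEq] at hhim ⊢
    rcases hhim with h | h | h
    · exact Or.inl h
    · omega
    · exact Or.inr h
  · rw [if_neg hlt] at hunf
    have hdec := sum_length_nextFirst_lt h1 h0
    cases its with
    | nil => exact absurd rfl h1
    | cons it rest =>
      obtain ⟨a, as', rfl, h3, h4⟩ := hb it (by simp)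
      obtain rfl : a = hi := by omega
      refine value a as' rest ?_ (not_lt.1 hu) hunf (ih _ (hN ▸ hdec) _ rfl)
      intro it hit
      obtain ⟨b, bs', rfl, h5, h6⟩ := hb it (by simp [hit])
      obtain rfl : b = a := by omega
      exact ⟨bs', rfl⟩

/-- Needed to charge each result tuple to the move that follows it. -/
theorem valuesFollowedByMove_leapfrog (u : ℤ) (its : List (List ℤ)) :
    ValuesFollowedByMove (leapfrog u its) := by
  induction its using leapfrog_induction (u := u) with
  | nil => rw [leapfrog_nil]; exact .nil
  | atEnd its h => rw [leapfrog_of_nil_mem h]; exact .nil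
  | exceeded its hi as h _ _ => rw [h]; exact .nil
  | seek pre lo as post hi _ _ _ _ h ih => rw [h]; exact .move ih
  | value hi as rest _ _ h ih => rw [h]; exact .value ih

/-! ### Correctness of leapfrog join -/

theorem mem_dropWhile_lt {hi y : ℤ} {as : List ℤ} (h : as.Pairwise (· < ·)) :
    y ∈ as.dropWhile (fun w => decide (w < hi)) ↔ y ∈ as ∧ hi ≤ y := by
  induction as with
  | nil => simp
  | cons a as ih =>
    rw [List.pairwise_cons] at h
    by_cases ha : a < hi
    · simp only [List.dropWhile_cons, ha, decide_true, if_true, ih h.2, List.mem_cons]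
      constructor
      · tauto
      · rintro ⟨rfl | h', h''⟩
        · omega
        · exact ⟨h', h''⟩
    · simp only [List.dropWhile_cons, ha, decide_false, Bool.false_eq_true, if_false, List.mem_cons]
      constructor
      · rintro (rfl | h')
        · exact ⟨Or.inl rfl, not_lt.1 ha⟩
        · have := h.1 y h'
          exact ⟨Or.inr h', by omega⟩
      · tauto

theorem AllIncreasing.seek {pre post : List (List ℤ)} {lo hi : ℤ} {as : List ℤ}
    (h : AllIncreasing (pre ++ (lo :: as) :: post)) :
    AllIncreasing (pre ++ (as.dropWhile fun w => decide (w < hi)) :: post) := by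
  intro it hit
  simp only [List.mem_append, List.mem_cons] at hit
  rcases hit with hit | rfl | hit
  · exact h it (by simp [hit])
  · exact (List.pairwise_cons.1 (h (lo :: as) (by simp))).2.sublist (List.dropWhile_sublist _)
  · exact h it (by simp [hit])

theorem AllIncreasing.next {rest : List (List ℤ)} {hi : ℤ} {as : List ℤ}
    (h : AllIncreasing ((hi :: as) :: rest)) : AllIncreasing (as :: rest) := by
  intro it hit
  rcases List.mem_cons.1 hit with rfl | hit
  · exact (List.pairwise_cons.1 (h (hi :: it) (by simp))).2
  · exact h it (by simp [hit])

theorem le_of_mem_cons {a y : ℤ} {as : List ℤ} (h : (a :: as).Pairwise (· < ·))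
    (hy : y ∈ a :: as) : a ≤ y := by
  rcases List.mem_cons.1 hy with rfl | hy
  · exact le_rfl
  · exact ((List.pairwise_cons.1 h).1 y hy).le

/-- Leapfrog join produces exactly the common keys up to `u`. -/
theorem mem_eventValues_leapfrog {u : ℤ} {its : List (List ℤ)} (hne : its ≠ [])
    (hs : AllIncreasing its) (y : ℤ) :
    y ∈ eventValues (leapfrog u its) ↔ y ≤ u ∧ ∀ it ∈ its, y ∈ it := by
  induction its using leapfrog_induction (u := u) with
  | nil => exact absurd rfl hne
  | atEnd its h =>
    rw [leapfrog_of_nil_mem h]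
    simp only [eventValues, List.not_mem_nil, false_iff, not_and]
    intro _ h'
    simpa using h' _ h
  | exceeded its hi as h hm hu =>
    rw [h]
    simp only [eventValues, List.not_mem_nil, false_iff, not_and]
    intro hy h'
    have := le_of_mem_cons (hs _ hm) (h' _ hm)
    omega
  | seek pre lo as post hi hb hhi hlt hu h ih =>
    rw [h, eventValues, ih (by simp) hs.seek]
    have hlo := List.pairwise_cons.1 (hs (lo :: as) (by simp))
    refine and_congr_right fun _ => ?_
    constructor
    · intro H it hit
      simp only [List.mem_append, List.mem_cons] at hit H
      rcases hit with hit | rfl | hit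
      · exact H it (Or.inl hit)
      · have := (mem_dropWhile_lt hlo.2).1 (H _ (Or.inr (Or.inl rfl)))
        exact List.mem_cons_of_mem _ this.1
      · exact H it (Or.inr (Or.inr hit))
    · intro H it hit
      obtain ⟨bs, hbs⟩ := hhi
      have hbs' : hi :: bs ∈ pre ++ (lo :: as) :: post := by
        simp only [List.mem_append, List.mem_cons] at hbs ⊢; tauto
      have hy := le_of_mem_cons (hs _ hbs') (H _ hbs')
      simp only [List.mem_append, List.mem_cons] at hit
      rcases hit with hit | rfl | hit
      · exact H it (by simp [hit])
      · refine (mem_dropWhile_lt hlo.2).2 ⟨?_, hy⟩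
        rcases List.mem_cons.1 (H (lo :: as) (by simp)) with rfl | h'
        · omega
        · exact h'
      · exact H it (by simp [hit])
  | value hi as rest hr hu h ih =>
    rw [h, eventValues, eventValues, List.mem_cons, ih (by simp) hs.next]
    constructor
    · rintro (rfl | ⟨h1, h2⟩)
      · refine ⟨hu, fun it hit => ?_⟩
        rcases List.mem_cons.1 hit with rfl | hit
        · simp
        · obtain ⟨bs, rfl⟩ := hr it hit; simp
      · refine ⟨h1, fun it hit => ?_⟩
        rcases List.mem_cons.1 hit with rfl | hit
        · exact List.mem_cons_of_mem _ (h2 _ (by simp))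
        · exact h2 it (by simp [hit])
    · rintro ⟨h1, h2⟩
      rcases List.mem_cons.1 (h2 (hi :: as) (by simp)) with rfl | h'
      · exact Or.inl rfl
      · refine Or.inr ⟨h1, fun it hit => ?_⟩
        rcases List.mem_cons.1 hit with rfl | hit
        · exact h'
        · exact h2 it (by simp [hit])

theorem pairwise_eventValues_leapfrog {u : ℤ} {its : List (List ℤ)} (hs : AllIncreasing its) :
    (eventValues (leapfrog u its)).Pairwise (· < ·) := by
  induction its using leapfrog_induction (u := u) with
  | nil => rw [leapfrog_nil]; exact .nil
  | atEnd its h => rw [leapfrog_of_nil_mem h]; exact .nil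
  | exceeded its hi as h _ _ => rw [h]; exact .nil
  | seek pre lo as post hi _ _ _ _ h ih => rw [h]; exact ih hs.seek
  | value hi as rest hr _ h ih =>
    rw [h, eventValues, eventValues, List.pairwise_cons]
    refine ⟨fun y hy => ?_, ih hs.next⟩
    have := ((mem_eventValues_leapfrog (by simp) hs.next y).1 hy).2 as (by simp)
    exact (List.pairwise_cons.1 (hs (hi :: as) (by simp))).1 y this

/-! ### Jump certificates for the number of moves -/

/-- `Paced its θ j`: after `j` jumps over gaps of single iterators, or over single keys, starting at
`θ`, one of the iterators has no further key.  Any leapfrog join follows such a sequence of jumps, up to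
a constant factor. -/
inductive Paced (its : List (List ℤ)) : ℤ → ℕ → Prop
  | done (θ : ℤ) (j : ℕ) (it : List ℤ) (hit : it ∈ its) (h : ∀ y ∈ it, y < θ) : Paced its θ j
  | jump (θ θ' : ℤ) (j : ℕ) (it : List ℤ) (hit : it ∈ its) (hle : θ ≤ θ')
      (h : ∀ y ∈ it, θ ≤ y → θ' ≤ y) (hp : Paced its θ' j) : Paced its θ (j + 1)
  | succ (θ : ℤ) (j : ℕ) (hp : Paced its (θ + 1) j) : Paced its θ (j + 1)

/-- Fewer keys mean larger gaps, so every jump stays legal. Only keys from `θ` on matter. This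
covers the restriction to a cube and the advance of an iterator, and also the way back from an
advanced iterator to the full list when all skipped keys lie below `θ`. -/
theorem Paced.mono {its its' : List (List ℤ)} {θ : ℤ} {j : ℕ} (hp : Paced its' θ j)
    (h : ∀ b ∈ its', ∃ a ∈ its, ∀ y ∈ a, θ ≤ y → y ∈ b) : Paced its θ j := by
  induction hp with
  | done θ j it hit hy =>
    obtain ⟨a, ha, hab⟩ := h it hit
    refine .done θ j a ha fun y hya => ?_
    by_contra! hθ
    have := hy y (hab y hya hθ)
    omega
  | jump θ θ' j it hit hle hy _ ih =>
    obtain ⟨a, ha, hab⟩ := h it hit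
    refine .jump θ θ' j a ha hle (fun y hya hθ => hy y (hab y hya hθ) hθ) (ih fun b hb => ?_)
    obtain ⟨a, ha, hab⟩ := h b hb
    exact ⟨a, ha, fun y hya hθ => hab y hya (hle.trans hθ)⟩
  | succ θ j _ ih =>
    refine .succ θ j (ih fun b hb => ?_)
    obtain ⟨a, ha, hab⟩ := h b hb
    exact ⟨a, ha, fun y hya hθ => hab y hya (by omega)⟩

theorem Paced.le {its : List (List ℤ)} {θ : ℤ} {j j' : ℕ} (hp : Paced its θ j) (h : j ≤ j') :
    Paced its θ j' := by
  induction hp generalizing j' with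
  | done θ j it hit hy => exact .done θ j' it hit hy
  | jump θ θ' j it hit hle hy _ ih =>
    obtain ⟨i, rfl⟩ : ∃ i, j' = i + 1 := ⟨j' - 1, by omega⟩
    exact .jump θ θ' i it hit hle hy (ih (by omega))
  | succ θ j _ ih =>
    obtain ⟨i, rfl⟩ : ∃ i, j' = i + 1 := ⟨j' - 1, by omega⟩
    exact .succ θ i (ih (by omega))

/-- The current key of the iterator is less than `θ`. -/
def headLT (θ : ℤ) (it : List ℤ) : Bool := it.head?.any fun a => decide (a < θ)

/-- A leapfrog join makes at most `k + 1` moves for each jump, where `k` is the number of iterators. -/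
theorem Paced.moveCount_le_aux {u : ℤ} {its : List (List ℤ)} (hs : AllIncreasing its) :
    ∀ {θ : ℤ} {j : ℕ}, Paced its θ j → (∃ a as, a :: as ∈ its ∧ θ ≤ a) →
      moveCount (leapfrog u its) ≤ (its.length + 1) * j + its.countP (headLT θ) := by
  induction its using leapfrog_induction (u := u) with
  | nil => rw [leapfrog_nil]; simp [moveCount]
  | atEnd its h => rw [leapfrog_of_nil_mem h]; simp [moveCount]
  | exceeded its hi as h _ _ => rw [h]; simp [moveCount]
  | seek pre lo as post hi hb hhi hlt _ h ih =>
    intro θ j hp hθ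
    obtain ⟨a, as', ha, hθa⟩ := hθ
    obtain ⟨bs, hbs⟩ := hhi
    have hθhi : θ ≤ hi := by
      obtain ⟨_, _, h1, _, h2⟩ := hb _ ha
      cases h1; omega
    have hlo := List.pairwise_cons.1 (hs (lo :: as) (by simp))
    have hex : ∀ θ', θ' ≤ hi →
        ∃ a as', a :: as' ∈ pre ++ (as.dropWhile fun w => decide (w < hi)) :: post ∧ θ' ≤ a := by
      intro θ' hθ'
      refine ⟨hi, bs, ?_, hθ'⟩
      simp only [List.mem_append, List.mem_cons] at hbs ⊢; tauto
    have hmono : ∀ θ' j', Paced (pre ++ (lo :: as) :: post) θ' j' →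
        Paced (pre ++ (as.dropWhile fun w => decide (w < hi)) :: post) θ' j' := by
      intro θ' j' hp'
      refine hp'.mono fun b hbm => ?_
      simp only [List.mem_append, List.mem_cons] at hbm
      rcases hbm with hbm | rfl | hbm
      · exact ⟨b, by simp [hbm], fun y hy _ => hy⟩
      · exact ⟨as.dropWhile fun w => decide (w < hi), by simp, fun y hy _ =>
          List.mem_cons_of_mem _ ((mem_dropWhile_lt hlo.2).1 hy).1⟩
      · exact ⟨b, by simp [hbm], fun y hy _ => hy⟩
    have hlen : (pre ++ (as.dropWhile fun w => decide (w < hi)) :: post).length =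
        (pre ++ (lo :: as) :: post).length := by simp
    rw [h, moveCount]
    -- The bound is a potential: `k + 1` for each remaining jump and one for each iterator whose key
    -- is below `θ`. If the sought iterator is behind `θ`, the seek takes it to `hi ≥ θ` or to its
    -- end, so the second term drops by one.
    by_cases hloθ : lo < θ
    · have h1 := ih hs.seek (hmono θ j hp) (hex θ hθhi)
      rw [hlen] at h1
      have h2 : headLT θ (as.dropWhile fun w => decide (w < hi)) = false := by
        cases hd : as.dropWhile fun w => decide (w < hi) with
        | nil => rfl
        | cons c cs =>
          have := ((mem_dropWhile_lt hlo.2).1 (hd ▸ List.mem_cons_self : c ∈ _)).2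
          simp [headLT]; omega
      have h3 : headLT θ (lo :: as) = true := by simp [headLT, hloθ]
      simp only [List.countP_append, List.countP_cons, h2, h3] at h1 ⊢
      simp only [Bool.false_eq_true, if_false, if_true] at h1 ⊢
      omega
    -- All keys are at least `θ`, so the next jump of the certificate is consumed. The count of
    -- iterators behind the new `θ'` is at most `k`, which together with this move is paid by the `k
    -- + 1` of the consumed jump.
    · have key : ∀ θ' j', θ' ≤ hi → Paced (pre ++ (lo :: as) :: post) θ' j' →
          moveCount (leapfrog u (pre ++ (as.dropWhile fun w => decide (w < hi)) :: post)) + 1 ≤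
            ((pre ++ (lo :: as) :: post).length + 1) * (j' + 1) := by
        intro θ' j' hθ' hp'
        have h1 := ih hs.seek (hmono θ' j' hp') (hex θ' hθ')
        have h2 := List.countP_le_length (p := headLT θ')
          (l := pre ++ (as.dropWhile fun w => decide (w < hi)) :: post)
        rw [hlen] at h1 h2
        rw [Nat.mul_succ]; omega
      -- The certificate cannot be finished, since every current key is at least `lo ≥ θ`. After a
      -- jump, the current key of the jumping iterator is at least `θ'`, hence so is `hi`; after a
      -- single step, `θ + 1 ≤ lo + 1 ≤ hi`.
      cases hp with
      | done _ _ it hit hy =>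
        obtain ⟨c, cs, rfl, hc, _⟩ := hb it hit
        have := hy c (by simp); omega
      | jump _ θ' j' it hit hle hy hp' =>
        obtain ⟨c, cs, rfl, hc, hc'⟩ := hb it hit
        have := hy c (by simp) (by omega)
        exact le_add_right (key θ' j' (by omega) hp')
      | succ _ j' hp' => exact le_add_right (key (θ + 1) j' (by omega) hp')
  | value hi as rest hr _ h ih =>
    intro θ j hp hθ
    obtain ⟨a, as', ha, hθa⟩ := hθ
    have hall : ∀ it ∈ (hi :: as) :: rest, ∃ bs, it = hi :: bs := by
      intro it hit
      rcases List.mem_cons.1 hit with rfl | hit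
      · exact ⟨as, rfl⟩
      · exact hr it hit
    have hθhi : θ ≤ hi := by
      obtain ⟨_, h1⟩ := hall _ ha
      cases h1; exact hθa
    rw [h, moveCount, moveCount]
    -- Here `θ'` may be `hi + 1`: the iterator moved by `next` then has a key at or above it, unless
    -- it is at its end and the join stops.
    have key : ∀ θ' j', θ' ≤ hi + 1 → Paced ((hi :: as) :: rest) θ' j' →
        moveCount (leapfrog u (as :: rest)) + 1 ≤ (((hi :: as) :: rest).length + 1) * (j' + 1) := by
      intro θ' j' hθ' hp'
      cases as with
      | nil =>
        rw [leapfrog_of_nil_mem (by simp), moveCount, Nat.mul_succ]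
        omega
      | cons c cs =>
        have hc := (List.pairwise_cons.1 (hs (hi :: c :: cs) (by simp))).1 c (by simp)
        have h1 := ih hs.next (θ := θ') (j := j') (hp'.mono fun b hb => ?_)
          ⟨c, cs, by simp, by omega⟩
        · have h2 := List.countP_le_length (p := headLT θ') (l := (c :: cs) :: rest)
          simp only [List.length_cons] at h1 h2 ⊢
          rw [Nat.mul_succ]; omega
        · rcases List.mem_cons.1 hb with rfl | hb
          · exact ⟨c :: cs, by simp, fun y hy _ => List.mem_cons_of_mem _ hy⟩
          · exact ⟨b, by simp [hb], fun y hy _ => hy⟩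
    cases hp with
    | done _ _ it hit hy =>
      obtain ⟨cs, rfl⟩ := hall it hit
      have := hy hi (by simp); omega
    | jump _ θ' j' it hit hle hy hp' =>
      obtain ⟨cs, rfl⟩ := hall it hit
      have := hy hi (by simp) hθhi
      exact le_add_right (key θ' j' (by omega) hp')
    | succ _ j' hp' => exact le_add_right (key (θ + 1) j' (by omega) hp')

theorem Paced.moveCount_le {u : ℤ} {its : List (List ℤ)} (hs : AllIncreasing its) {θ : ℤ} {j : ℕ}
    (hp : Paced its θ j) (hθ : ∃ a as, a :: as ∈ its ∧ θ ≤ a) :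
    moveCount (leapfrog u its) ≤ (its.length + 1) * (j + 1) := by
  have h1 := hp.moveCount_le_aux (u := u) hs hθ
  have h2 := List.countP_le_length (p := headLT θ) (l := its)
  rw [Nat.mul_succ]; omega

/-- A sorted iterator has at most two jumps for each of its keys. -/
theorem paced_of_mem {its : List (List ℤ)} {it l : List ℤ} (hit : it ∈ its)
    (hs : l.Pairwise (· < ·)) {θ : ℤ} (h : ∀ y ∈ it, θ ≤ y → y ∈ l) :
    Paced its θ (2 * l.length) := by
  induction l generalizing θ with
  | nil =>
    refine .done _ _ it hit fun y hy => ?_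
    by_contra! hθ
    simpa using h y hy hθ
  | cons a as ih =>
    rw [List.pairwise_cons] at hs
    -- The maximum covers a `θ` already beyond `a`, where the key `a` needs no jump at all.
    -- Otherwise one jump reaches `a` and one single step passes it.
    have h1 := ih hs.2 (θ := max (a + 1) θ) fun y hy hθ => by
      rcases List.mem_cons.1 (h y hy (by omega)) with rfl | h'
      · omega
      · exact h'
    rw [List.length_cons]
    rcases le_or_gt θ a with hθa | hθa
    · rw [max_eq_left (by omega)] at h1
      refine .jump θ a _ it hit hθa (fun y hy hθ => ?_) (.succ _ _ h1)
      rcases List.mem_cons.1 (h y hy hθ) with rfl | h'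
      · exact le_rfl
      · exact (hs.1 y h').le
    · rw [max_eq_right (by omega)] at h1
      exact h1.le (by omega)

/-- The number of moves is linear in the length of each of the lists. -/
theorem moveCount_leapfrog_le {u : ℤ} {its : List (List ℤ)} (hs : AllIncreasing its) {it : List ℤ}
    (hit : it ∈ its) : moveCount (leapfrog u its) ≤ (its.length + 1) * (2 * it.length + 1) := by
  cases it with
  | nil => rw [leapfrog_of_nil_mem hit]; simp [moveCount]
  | cons a as =>
    exact (paced_of_mem hit (hs _ hit) (θ := a) fun y hy _ => hy).moveCount_le hs
      ⟨a, as, hit, le_rfl⟩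

/-- The moves of a complete leapfrog join are a sequence of jumps. -/
theorem paced_of_leapfrog {u : ℤ} {its : List (List ℤ)} (hs : AllIncreasing its)
    (hu : ∀ it ∈ its, ∀ y ∈ it, y ≤ u) (hne : its ≠ []) (h0 : [] ∉ its) :
    ∃ hi as, hi :: as ∈ its ∧ (∀ a as, a :: as ∈ its → a ≤ hi) ∧
      Paced its hi (2 * moveCount (leapfrog u its)) := by
  induction its using leapfrog_induction (u := u) with
  | nil => exact absurd rfl hne
  | atEnd its h => exact absurd h h0
  | exceeded its hi as h hm hlt =>
    have := hu _ hm hi (by simp)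
    omega
  | seek pre lo as post hi hb hhi hlt _ h ih =>
    obtain ⟨bs, hbs⟩ := hhi
    have hbs' : ∀ it, hi :: bs ∈ pre ++ it :: post := by
      intro it
      simp only [List.mem_append, List.mem_cons] at hbs ⊢; tauto
    have hlo := List.pairwise_cons.1 (hs (lo :: as) (by simp))
    refine ⟨hi, bs, hbs' _, fun a as ha => ?_, ?_⟩
    · obtain ⟨_, _, h1, _, h2⟩ := hb _ ha
      cases h1; exact h2
    rw [h, moveCount]
    -- If the seek runs off the end, the sought iterator has no key from `hi` on and the certificate
    -- ends here.
    by_cases hd : as.dropWhile (fun w => decide (w < hi)) = []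
    · refine .done _ _ (lo :: as) (by simp) fun y hy => ?_
      by_contra! hθ
      have hya : y ∈ as := by
        rcases List.mem_cons.1 hy with rfl | hy
        · omega
        · exact hy
      have := (mem_dropWhile_lt hlo.2).2 ⟨hya, hθ⟩
      simp [hd] at this
    obtain ⟨c, cs, hc⟩ := List.exists_cons_of_ne_nil hd
    have hc' := (mem_dropWhile_lt hlo.2).1 (hc ▸ List.mem_cons_self : c ∈ _)
    have h0' : [] ∉ pre ++ (as.dropWhile fun w => decide (w < hi)) :: post := by
      simp only [List.mem_append, List.mem_cons, not_or] at h0 ⊢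
      exact ⟨h0.1, fun h => hd h.symm, h0.2.2⟩
    obtain ⟨hi', as', hm, hmax, hp⟩ := ih hs.seek (fun it hit y hy => by
      simp only [List.mem_append, List.mem_cons] at hit
      rcases hit with hit | rfl | hit
      · exact hu it (by simp [hit]) y hy
      · exact hu (lo :: as) (by simp) y
          (List.mem_cons_of_mem _ ((mem_dropWhile_lt hlo.2).1 hy).1)
      · exact hu it (by simp [hit]) y hy) (by simp) h0'
    have hle : hi ≤ hi' := hmax _ _ (hbs' _)
    -- The new greatest key is either an old one, hence at most `hi ≤ c`, or the key `c` just
    -- reached. So the sought iterator has no key in `[hi, hi')`, which justifies one jump from `hi`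
    -- to `hi'`.
    have hhi' : hi' ≤ c := by
      simp only [List.mem_append, List.mem_cons] at hm
      rcases hm with hm | hm | hm
      · obtain ⟨_, _, h1, _, h2⟩ := hb _ (by simp [hm] : hi' :: as' ∈ _)
        cases h1; omega
      · rw [hc] at hm; cases hm; exact le_rfl
      · obtain ⟨_, _, h1, _, h2⟩ := hb _ (by simp [hm] : hi' :: as' ∈ _)
        cases h1; omega
    refine (Paced.jump hi hi' _ (lo :: as) (by simp) hle (fun y hy hθ => ?_)
      (hp.mono fun b hb' => ?_)).le (j := 2 * moveCount (leapfrog u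
        (pre ++ (as.dropWhile fun w => decide (w < hi)) :: post)) + 1) (by omega)
    · rcases List.mem_cons.1 hy with rfl | hy
      · omega
      · have h3 := (mem_dropWhile_lt hlo.2).2 ⟨hy, hθ⟩
        have h4 := hs.seek (hi := hi) (as.dropWhile fun w => decide (w < hi)) (by simp)
        rw [hc] at h3 h4
        exact hhi'.trans (le_of_mem_cons h4 h3)
    · simp only [List.mem_append, List.mem_cons] at hb'
      rcases hb' with hb' | rfl | hb'
      · exact ⟨b, by simp [hb'], fun y hy _ => hy⟩
      · refine ⟨lo :: as, by simp, fun y hy hθ => (mem_dropWhile_lt hlo.2).2 ⟨?_, by omega⟩⟩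
        rcases List.mem_cons.1 hy with rfl | hy
        · omega
        · exact hy
      · exact ⟨b, by simp [hb'], fun y hy _ => hy⟩
  | value hi as rest hr _ h ih =>
    have hhi := List.pairwise_cons.1 (hs (hi :: as) (by simp))
    refine ⟨hi, as, by simp, fun a as' ha => ?_, ?_⟩
    · rcases List.mem_cons.1 ha with ha | ha
      · cases ha; exact le_rfl
      · obtain ⟨_, h1⟩ := hr _ ha
        cases h1; exact le_rfl
    rw [h, moveCount, moveCount, Nat.mul_succ]
    -- The single move after a common value corresponds to two steps of the certificate: a step over
    -- the key `hi`, then a jump to the next key of the advanced iterator. This is the origin of the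
    -- factor 2.
    refine .succ _ _ ?_
    cases as with
    | nil =>
      refine .done _ _ [hi] (by simp) fun y hy => ?_
      have := List.mem_singleton.1 hy
      omega
    | cons c cs =>
      obtain ⟨hi', as', hm, hmax, hp⟩ := ih hs.next (fun it hit y hy => by
        rcases List.mem_cons.1 hit with rfl | hit
        · exact hu (hi :: c :: cs) (by simp) y (List.mem_cons_of_mem _ hy)
        · exact hu it (by simp [hit]) y hy) (by simp) (by
          simp only [List.mem_cons, not_or] at h0 ⊢
          exact ⟨by simp, h0.2⟩)
      have hc := hhi.1 c (by simp)
      have hle : c ≤ hi' := hmax c cs (by simp)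
      have hhi' : hi' = c := by
        rcases List.mem_cons.1 hm with hm | hm
        · cases hm; rfl
        · obtain ⟨_, h1⟩ := hr _ hm
          cases h1; omega
      subst hhi'
      refine .jump (hi + 1) hi' _ (hi :: hi' :: cs) (by simp) (by omega) (fun y hy hθ => ?_)
        (hp.mono fun b hb => ?_)
      · rcases List.mem_cons.1 hy with rfl | hy
        · omega
        · exact le_of_mem_cons hhi.2 hy
      · rcases List.mem_cons.1 hb with rfl | hb
        · refine ⟨hi :: hi' :: cs, by simp, fun y hy hθ => ?_⟩
          rcases List.mem_cons.1 hy with rfl | hy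
          · omega
          · exact hy
        · exact ⟨b, by simp [hb], fun y hy _ => hy⟩

/-- Restricting the iterators to an interval does not increase the number of moves by more than a
constant factor and a constant. -/
theorem moveCount_leapfrog_restrict_le {u u' l : ℤ} {its : List (List ℤ)} (hs : AllIncreasing its)
    (hu : ∀ it ∈ its, ∀ y ∈ it, y ≤ u) :
    moveCount (leapfrog u' (its.map fun it => it.dropWhile fun w => decide (w < l))) ≤
      (its.length + 1) * (2 * moveCount (leapfrog u its) + 1) := by
  by_cases h0 : [] ∈ its
  · rw [leapfrog_of_nil_mem (List.mem_map.2 ⟨[], h0, rfl⟩)]; simp [moveCount]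
  by_cases hne : its = []
  · subst hne; simp [leapfrog_nil, moveCount]
  obtain ⟨hi, as, hm, -, hp⟩ := paced_of_leapfrog hs hu hne h0
  set its' := its.map fun it => it.dropWhile fun w => decide (w < l) with hits'
  have hs' : AllIncreasing its' := by
    intro it hit
    obtain ⟨it', hit', rfl⟩ := List.mem_map.1 hit
    exact (hs it' hit').sublist (List.dropWhile_sublist _)
  have hm' : (hi :: as).dropWhile (fun w => decide (w < l)) ∈ its' :=
    List.mem_map.2 ⟨_, hm, rfl⟩
  -- The iterator that had the key `hi` is either exhausted by the restriction, so that the join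
  -- ends at once, or its new first key is still at least `hi`, which is where the certificate
  -- starts.
  cases hd : (hi :: as).dropWhile (fun w => decide (w < l)) with
  | nil => rw [leapfrog_of_nil_mem (hd ▸ hm')]; simp [moveCount]
  | cons c cs =>
    have hc := ((mem_dropWhile_lt (hs _ hm)).1 (hd ▸ List.mem_cons_self : c ∈ _)).1
    have := (hp.mono (its := its') fun b hb => ⟨_, List.mem_map.2 ⟨b, hb, rfl⟩, fun y hy _ =>
      ((mem_dropWhile_lt (hs b hb)).1 hy).1⟩).moveCount_le (u := u') hs'
        ⟨c, cs, hd ▸ hm', le_of_mem_cons (hs _ hm) hc⟩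
    simpa [hits'] using this

/-! ### The anytime triejoin of a cube -/

theorem opCost_pos (q : JoinQuery) (D : Instance q) : 1 ≤ opCost q D := Nat.le_add_right 1 _

theorem length_relationsWith_le (q : JoinQuery) (x : Fin q.numAttr) :
    (relationsWith q x).length ≤ q.numRel := by
  rw [relationsWith]
  simpa using List.length_filterMap_le (fun e => if h : x ∈ q.attrs e then
    some (⟨e, h⟩ : {e : Fin q.numRel // x ∈ q.attrs e}) else none) (List.finRange q.numRel)

theorem mem_relationsWith (q : JoinQuery) (x : Fin q.numAttr)
    (e : {e : Fin q.numRel // x ∈ q.attrs e}) : e ∈ relationsWith q x := by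
  rw [relationsWith, List.mem_filterMap]
  exact ⟨e.1, List.mem_finRange _, by simp [e.2]⟩

theorem length_relationsWith_pos (q : JoinQuery) (x : Fin q.numAttr) :
    1 ≤ (relationsWith q x).length := by
  obtain ⟨e, he⟩ := q.covered x
  exact List.length_pos_of_mem (mem_relationsWith q x ⟨e, he⟩)

theorem mem_trieLevel {q : JoinQuery} {D : Instance q} {M : Assignment q} {x : Fin q.numAttr}
    {e : {e : Fin q.numRel // x ∈ q.attrs e}} {v : ℤ} :
    v ∈ trieLevel q D M x e ↔
      ∃ t ∈ D e.1, (∀ y, ∀ h : y ∈ q.attrs e.1, M y = none ∨ M y = some (t y h)) ∧ t x e.2 = v := by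
  simp only [trieLevel, Finset.mem_sort, Finset.mem_image, Finset.mem_filter, and_assoc]

theorem pairwise_trieLevel (q : JoinQuery) (D : Instance q) (M : Assignment q) (x : Fin q.numAttr)
    (e : {e : Fin q.numRel // x ∈ q.attrs e}) : (trieLevel q D M x e).Pairwise (· < ·) :=
  (Finset.sortedLT_sort _).pairwise

/-- The leapfrog events for attribute `x` at the trie node given by `M`, restricted to the cube `c`. -/
def levelEvents (q : JoinQuery) (D : Instance q) (c : Cube q.numAttr) (M : Assignment q)
    (x : Fin q.numAttr) : List LeapfrogEvent :=
  leapfrog (c.hi x) ((relationsWith q x).map fun e =>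
    (trieLevel q D M x e).dropWhile fun w => decide (w < c.lo x))

theorem allIncreasing_level (q : JoinQuery) (D : Instance q) (M : Assignment q)
    (x : Fin q.numAttr) (l : ℤ) : AllIncreasing ((relationsWith q x).map fun e =>
      (trieLevel q D M x e).dropWhile fun w => decide (w < l)) := by
  intro it hit
  obtain ⟨e, -, rfl⟩ := List.mem_map.1 hit
  exact (pairwise_trieLevel q D M x e).sublist (List.dropWhile_sublist _)

theorem pairwise_eventValues_levelEvents (q : JoinQuery) (D : Instance q) (c : Cube q.numAttr)
    (M : Assignment q) (x : Fin q.numAttr) :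
    (eventValues (levelEvents q D c M x)).Pairwise (· < ·) :=
  pairwise_eventValues_leapfrog (allIncreasing_level q D M x _)

theorem mem_eventValues_levelEvents {q : JoinQuery} {D : Instance q} {c : Cube q.numAttr}
    {M : Assignment q} {x : Fin q.numAttr} {v : ℤ} :
    v ∈ eventValues (levelEvents q D c M x) ↔
      c.lo x ≤ v ∧ v ≤ c.hi x ∧ ∀ e, v ∈ trieLevel q D M x e := by
  have hne := length_relationsWith_pos q x
  rw [levelEvents, mem_eventValues_leapfrog (by
    intro h
    rw [List.map_eq_nil_iff] at h
    simp [h] at hne) (allIncreasing_level q D M x _)]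
  simp only [List.mem_map, forall_exists_index, and_imp, forall_apply_eq_imp_iff₂,
    mem_dropWhile_lt (pairwise_trieLevel q D M x _)]
  constructor
  · rintro ⟨h1, h2⟩
    have h3 := fun e => h2 e (mem_relationsWith q x e)
    obtain ⟨e, he⟩ := q.covered x
    exact ⟨(h3 ⟨e, he⟩).2, h1, fun e => (h3 e).1⟩
  · rintro ⟨h1, h2, h3⟩
    exact ⟨h2, fun e _ => ⟨h3 e, h1⟩⟩

theorem joinRec_cons (q : JoinQuery) (D : Instance q) (b : ℕ∞) (c : Cube q.numAttr)
    (x : Fin q.numAttr) (xs : List (Fin q.numAttr)) (M : Assignment q) (s : ℕ) :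
    joinRec q D b c (x :: xs) M s =
      scan b c x (opCost q D + (relationsWith q x).length)
        (fun v s' => joinRec q D b c xs (Function.update M x (some v)) s')
        (levelEvents q D c M x) (s + 3 * (relationsWith q x).length * opCost q D) := rfl

/-- The number of steps of the triejoin without a budget. -/
def triejoinCost (q : JoinQuery) (D : Instance q) (c : Cube q.numAttr) :
    List (Fin q.numAttr) → Assignment q → ℕ
  | [], _ => q.numAttr
  | x :: xs, M =>
    3 * (relationsWith q x).length * opCost q D +
      ((opCost q D + (relationsWith q x).length) * moveCount (levelEvents q D c M x) +
        ((eventValues (levelEvents q D c M x)).map fun v =>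
          triejoinCost q D c xs (Function.update M x (some v))).sum)

/-! ### The loop over the values of one attribute -/

section Scan

variable {q : JoinQuery} {b : ℕ∞} {c : Cube q.numAttr} {x : Fin q.numAttr} {w : ℕ}
  {child : ℤ → ℕ → JoinOutcome q}

theorem scan_move (es : List LeapfrogEvent) (s : ℕ) :
    scan b c x w child (.move :: es) s = scan b c x w child es (s + w) := rfl

theorem scan_value_of_lt {v : ℤ} (es : List LeapfrogEvent) {s : ℕ}
    (h : b < ((child v s).steps : ℕ∞)) :
    scan b c x w child (.value v :: es) s =
      ⟨(child v s).inserted, (child v s).steps, Function.update (child v s).last x v⟩ := by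
  rw [scan]; simp [h]

theorem scan_value_of_not_lt {v : ℤ} (es : List LeapfrogEvent) {s : ℕ}
    (h : ¬ b < ((child v s).steps : ℕ∞)) :
    scan b c x w child (.value v :: es) s =
      ⟨(child v s).inserted ++ (scan b c x w child es (child v s).steps).inserted,
        (scan b c x w child es (child v s).steps).steps,
        (scan b c x w child es (child v s).steps).last⟩ := by
  rw [scan]; simp only [h, if_false]

theorem scan_steps_le {κ : ℤ → ℕ} (h : ∀ v s, (child v s).steps ≤ s + κ v)
    (es : List LeapfrogEvent) (s : ℕ) :
    (scan b c x w child es s).steps ≤ s + (w * moveCount es + ((eventValues es).map κ).sum) := by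
  induction es generalizing s with
  | nil => simp [scan, moveCount, eventValues]
  | cons ev es ih =>
    cases ev with
    | move =>
      have := ih (s + w)
      rw [scan_move, moveCount, eventValues, Nat.mul_succ]; omega
    | value v =>
      have h1 := h v s
      have h2 := ih (child v s).steps
      rw [moveCount, eventValues, List.map_cons, List.sum_cons]
      by_cases hb : b < ((child v s).steps : ℕ∞)
      · rw [scan_value_of_lt es hb]; dsimp only; omega
      · rw [scan_value_of_not_lt es hb]; dsimp only; omega

theorem scan_steps_top {κ : ℤ → ℕ} (h : ∀ v s, (child v s).steps = s + κ v)
    (es : List LeapfrogEvent) (s : ℕ) :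
    (scan ⊤ c x w child es s).steps = s + (w * moveCount es + ((eventValues es).map κ).sum) := by
  induction es generalizing s with
  | nil => simp [scan, moveCount, eventValues]
  | cons ev es ih =>
    cases ev with
    | move =>
      have := ih (s + w)
      rw [scan_move, moveCount, eventValues, Nat.mul_succ]; omega
    | value v =>
      have h1 := h v s
      have h2 := ih (child v s).steps
      rw [moveCount, eventValues, List.map_cons, List.sum_cons,
        scan_value_of_not_lt es (by simp)]
      dsimp only; omega

theorem scan_last (es : List LeapfrogEvent) (s : ℕ) :
    b < ((scan b c x w child es s).steps : ℕ∞) ∨ (scan b c x w child es s).last = c.hi := by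
  induction es generalizing s with
  | nil => exact Or.inr rfl
  | cons ev es ih =>
    cases ev with
    | move => exact ih _
    | value v =>
      by_cases hb : b < ((child v s).steps : ℕ∞)
      · rw [scan_value_of_lt es hb]; exact Or.inl hb
      · rw [scan_value_of_not_lt es hb]; exact ih _

theorem scan_inserted_le {k : ℕ} (h : ∀ v s, (child v s).inserted.length * k + s ≤ (child v s).steps)
    (es : List LeapfrogEvent) (s : ℕ) :
    (scan b c x w child es s).inserted.length * k + s ≤ (scan b c x w child es s).steps := by
  induction es generalizing s with
  | nil => simp [scan]
  | cons ev es ih =>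
    cases ev with
    | move =>
      have := ih (s + w)
      rw [scan_move]; omega
    | value v =>
      have h1 := h v s
      have h2 := ih (child v s).steps
      by_cases hb : b < ((child v s).steps : ℕ∞)
      · rw [scan_value_of_lt es hb]; exact h1
      · rw [scan_value_of_not_lt es hb]
        dsimp only
        rw [List.length_append, add_mul]; omega

/-- On the last attribute each value inserts one tuple, paid by the move after it. A timeout can
suppress this move for one value only; hence the extra `k` on the right. -/
theorem scan_inserted_le_of_single {k : ℕ} (hk : k ≤ w)
    (h : ∀ v s, (child v s).inserted.length = 1 ∧ s ≤ (child v s).steps)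
    {es : List LeapfrogEvent} (hes : ValuesFollowedByMove es) (s : ℕ) :
    (scan b c x w child es s).inserted.length * k + s ≤ (scan b c x w child es s).steps + k := by
  induction hes generalizing s with
  | nil => simp [scan]
  | move _ ih =>
    have := ih (s + w)
    rw [scan_move]; omega
  | @value v es _ ih =>
    obtain ⟨h1, h2⟩ := h v s
    have h3 := ih ((child v s).steps + w)
    by_cases hb : b < ((child v s).steps : ℕ∞)
    · rw [scan_value_of_lt _ hb]
      dsimp only
      rw [h1]; omega
    · rw [scan_value_of_not_lt _ hb, scan_move]
      dsimp only
      rw [List.length_append, h1, add_mul]; omega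

/-- The attributes of `xs` up to some `y` have been left at the values `v`, which agree with `t` before
`y` and are smaller than `t` at `y`. -/
def LeftBefore {m : ℕ} (xs : List (Fin m)) (v t : Fin m → ℤ) : Prop :=
  ∃ ys y zs, xs = ys ++ y :: zs ∧ (∀ a ∈ ys, v a = t a) ∧ v y < t y

/-- Values come in increasing order, so a timeout at a value other than `t x` before `t x` is
reached happens at a smaller one, and the loop is left before `t` at `x` itself. When `t x` is
reached, its recursive call either inserts the tuple or exceeds the budget; in the latter case the
loop stops there, with `x` left at `t x`, and the inner attributes witness the claim. -/
theorem scan_cover {xs : List (Fin q.numAttr)} {t : Fin q.numAttr → ℤ} {T : Assignment q}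
    (hx : x ∉ xs)
    (h : ∀ s, T ∈ (child (t x) s).inserted ∨
      (b < ((child (t x) s).steps : ℕ∞) ∧ LeftBefore xs (child (t x) s).last t))
    {es : List LeapfrogEvent} (hes : (eventValues es).Pairwise (· < ·)) (hm : t x ∈ eventValues es)
    (s : ℕ) :
    T ∈ (scan b c x w child es s).inserted ∨ LeftBefore (x :: xs) (scan b c x w child es s).last t := by
  induction es generalizing s with
  | nil => simp [eventValues] at hm
  | cons ev es ih =>
    cases ev with
    | move => exact ih hes hm _
    | value v =>
      rw [eventValues, List.pairwise_cons] at hes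
      by_cases hb : b < ((child v s).steps : ℕ∞)
      · rw [scan_value_of_lt es hb]
        dsimp only
        rcases List.mem_cons.1 hm with h1 | h1
        · rw [← h1]
          refine (h s).imp id fun ⟨_, ys, y, zs, hxs, hys, hy⟩ => ?_
          refine ⟨x :: ys, y, zs, by simp [hxs], fun a ha => ?_, ?_⟩
          · rcases List.mem_cons.1 ha with rfl | ha
            · simp
            · rw [Function.update_of_ne (fun hax => hx (by simp [hxs, ← hax, ha]))]
              exact hys a ha
          · rw [Function.update_of_ne]
            · exact hy
            · rintro rfl; exact hx (by simp [hxs])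
        · exact Or.inr ⟨[], x, xs, rfl, by simp, by simpa using hes.1 _ h1⟩
      · rw [scan_value_of_not_lt es hb]
        dsimp only
        rw [List.mem_append]
        rcases List.mem_cons.1 hm with h1 | h1
        · rw [← h1] at hb ⊢
          exact Or.inl (Or.inl ((h s).resolve_right fun h2 => hb h2.1))
        · exact (ih hes.2 h1 _).imp Or.inr id

end Scan

/-- A timeout only cuts off events. -/
theorem joinRec_steps_le (q : JoinQuery) (D : Instance q) (b : ℕ∞) (c : Cube q.numAttr)
    (xs : List (Fin q.numAttr)) (M : Assignment q) (s : ℕ) :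
    (joinRec q D b c xs M s).steps ≤ s + triejoinCost q D c xs M := by
  induction xs generalizing M s with
  | nil => exact le_rfl
  | cons x xs ih =>
    rw [joinRec_cons, triejoinCost, ← add_assoc]
    exact scan_steps_le (fun v s => ih (Function.update M x (some v)) s) _ _

theorem joinRec_steps_top (q : JoinQuery) (D : Instance q) (c : Cube q.numAttr)
    (xs : List (Fin q.numAttr)) (M : Assignment q) (s : ℕ) :
    (joinRec q D ⊤ c xs M s).steps = s + triejoinCost q D c xs M := by
  induction xs generalizing M s with
  | nil => rfl
  | cons x xs ih =>
    rw [joinRec_cons, triejoinCost, ← add_assoc]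
    exact scan_steps_top (fun v s => ih (Function.update M x (some v)) s) _ _

theorem joinRec_last (q : JoinQuery) (D : Instance q) (b : ℕ∞) (c : Cube q.numAttr)
    (xs : List (Fin q.numAttr)) (M : Assignment q) (s : ℕ) :
    b < ((joinRec q D b c xs M s).steps : ℕ∞) ∨ (joinRec q D b c xs M s).last = c.hi := by
  cases xs with
  | nil => exact Or.inr rfl
  | cons x xs => exact scan_last _ _

/-- Each inserted tuple costs at least one iterator operation. -/
theorem joinRec_inserted_le (q : JoinQuery) (D : Instance q) (b : ℕ∞) (c : Cube q.numAttr)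
    (x : Fin q.numAttr) (xs : List (Fin q.numAttr)) (M : Assignment q) (s : ℕ) :
    (joinRec q D b c (x :: xs) M s).inserted.length * opCost q D + s ≤
      (joinRec q D b c (x :: xs) M s).steps := by
  induction xs generalizing x M s with
  | nil =>
    rw [joinRec_cons]
    have h1 := scan_inserted_le_of_single (b := b) (c := c) (x := x) (k := opCost q D)
      (Nat.le_add_right (opCost q D) (relationsWith q x).length)
      (child := fun v s' => joinRec q D b c [] (Function.update M x (some v)) s')
      (fun v s => ⟨rfl, Nat.le_add_right _ _⟩)
      (valuesFollowedByMove_leapfrog (c.hi x) ((relationsWith q x).map fun e =>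
        (trieLevel q D M x e).dropWhile fun w => decide (w < c.lo x)))
      (s + 3 * (relationsWith q x).length * opCost q D)
    -- Opening the level pays for the one tuple that a timeout may leave without a subsequent move.
    have h2 : 1 * opCost q D ≤ 3 * (relationsWith q x).length * opCost q D :=
      Nat.mul_le_mul_right _ (by have := length_relationsWith_pos q x; omega)
    rw [levelEvents]
    omega
  | cons y ys ih =>
    rw [joinRec_cons]
    have h1 := scan_inserted_le (b := b) (c := c) (x := x) (k := opCost q D)
      (w := opCost q D + (relationsWith q x).length)
      (child := fun v s' => joinRec q D b c (y :: ys) (Function.update M x (some v)) s')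
      (fun v s => ih y _ s) (levelEvents q D c M x)
      (s + 3 * (relationsWith q x).length * opCost q D)
    omega

/-- The point `t` lies in the cube. -/
def Cube.Contains {m : ℕ} (c : Cube m) (t : Fin m → ℤ) : Prop := ∀ x, c.lo x ≤ t x ∧ t x ≤ c.hi x

theorem Cube.Contains.isNonempty {m : ℕ} {c : Cube m} {t : Fin m → ℤ} (h : c.Contains t) :
    c.IsNonempty := fun x => (h x).1.trans (h x).2

/-- Induction over the attributes through `scan_cover`. An inner call can miss `t` only by exceeding
the budget: otherwise its last values are the upper bounds of the cube, and no coordinate of `t`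
lies above these. -/
theorem joinRec_cover {q : JoinQuery} {D : Instance q} (b : ℕ∞) {c : Cube q.numAttr}
    {t : Fin q.numAttr → ℤ} (ht : t ∈ joinResult q D) (hc : c.Contains t)
    {xs : List (Fin q.numAttr)} (hxs : xs.Nodup) {M : Assignment q}
    (hM : ∀ y, M y = none ∨ M y = some (t y)) (hM' : ∀ y, y ∈ xs ∨ M y = some (t y)) (s : ℕ) :
    (fun x => some (t x)) ∈ (joinRec q D b c xs M s).inserted ∨
      LeftBefore xs (joinRec q D b c xs M s).last t := by
  induction xs generalizing M s with
  | nil =>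
    refine Or.inl (List.mem_singleton.2 ?_)
    funext y
    exact ((hM' y).resolve_left (by simp)).symm
  | cons x xs ih =>
    rw [List.nodup_cons] at hxs
    rw [joinRec_cons]
    refine scan_cover hxs.1 (fun s => ?_) (pairwise_eventValues_levelEvents q D c M x) ?_ _
    · refine (ih hxs.2 (M := Function.update M x (some (t x))) ?_ ?_ s).imp id fun hl => ⟨?_, hl⟩
      · intro y
        by_cases hy : y = x
        · subst hy; simp
        · rw [Function.update_of_ne hy]; exact hM y
      · intro y
        by_cases hy : y = x
        · subst hy; simp
        · rw [Function.update_of_ne hy]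
          exact (hM' y).imp (fun h => (List.mem_cons.1 h).resolve_left hy) id
      · refine (joinRec_last q D b c xs _ s).resolve_right fun h => ?_
        obtain ⟨ys, y, zs, -, -, h3⟩ := hl
        rw [h] at h3
        have := (hc y).2
        omega
    · rw [mem_eventValues_levelEvents]
      exact ⟨(hc x).1, (hc x).2, fun e => mem_trieLevel.2 ⟨_, ht e.1, fun y _ => hM y, rfl⟩⟩

/-! ### One cube, its remainder, and the query cube -/

section OneCube

variable {q : JoinQuery} {D : Instance q} {b : ℕ∞} {o : AttrOrder q} {c : Cube q.numAttr}

theorem joinOneCube_steps_le :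
    (joinOneCube q D b o c).steps ≤ (joinOneCube q D ⊤ o c).steps := by
  rw [joinOneCube, joinOneCube, joinRec_steps_top]
  exact joinRec_steps_le _ _ _ _ _ _ _

theorem joinOneCube_last :
    b < ((joinOneCube q D b o c).steps : ℕ∞) ∨ (joinOneCube q D b o c).last = c.hi :=
  joinRec_last _ _ _ _ _ _ _

theorem joinOneCube_inserted_le :
    (joinOneCube q D b o c).inserted.length * opCost q D ≤ (joinOneCube q D b o c).steps := by
  rw [joinOneCube]
  cases h : List.ofFn o with
  | nil =>
    have := q.numAttr_pos
    have h2 := congrArg List.length h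
    simp at h2; omega
  | cons x xs => exact joinRec_inserted_le q D b c x xs _ 0

theorem length_remainder_le {m : ℕ} (o : Equiv.Perm (Fin m)) (c : Cube m) (v : Fin m → ℤ) :
    (remainder o c v).length ≤ m :=
  (List.length_filter_le _ _).trans (by simp)

/-- Each candidate has the empty range `(c.hi y, c.hi y]` at its own attribute. -/
theorem remainder_hi {m : ℕ} (o : Equiv.Perm (Fin m)) (c : Cube m) : remainder o c c.hi = [] := by
  rw [remainder, List.filter_eq_nil_iff]
  intro c' hc'
  obtain ⟨i, -, rfl⟩ := List.mem_map.1 hc'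
  simp only [decide_eq_true_eq]
  intro h
  simpa [remainderAt] using h (o i)

/-- The right cube is the one for the position of the first attribute `y` at which `v` and `t`
differ: `t` agrees with `v` before it, satisfies `v y + 1 ≤ t y`, and is unrestricted within `c`
afterwards. -/
theorem exists_mem_remainder {m : ℕ} {o : Equiv.Perm (Fin m)} {c : Cube m} {v t : Fin m → ℤ}
    (hc : c.Contains t) (h : LeftBefore (List.ofFn o) v t) :
    ∃ c' ∈ remainder o c v, c'.Contains t := by
  obtain ⟨ys, y, zs, hl, hys, hy⟩ := h
  have hlen : ys.length < m := by
    have := congrArg List.length hl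
    simp at this; omega
  set i : Fin m := ⟨ys.length, hlen⟩ with hi
  have hget : ∀ (j : ℕ) (hj : j < m), (ys ++ y :: zs)[j]? = some (o ⟨j, hj⟩) := by
    intro j hj
    rw [← hl]; simp [hj]
  have hoi : o i = y := by
    have := hget ys.length hlen
    simpa using this.symm
  have hbefore : ∀ x, o.symm x < i → x ∈ ys := by
    intro x hx
    have h1 := hget (o.symm x).1 (o.symm x).2
    rw [List.getElem?_append_left (by exact hx)] at h1
    have h2 := List.mem_of_getElem? h1
    simpa using h2
  have hcont : (remainderAt o c v i).Contains t := by
    intro x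
    simp only [remainderAt]
    by_cases h1 : o.symm x < i
    · have := hys x (hbefore x h1)
      simp [h1, this]
    · by_cases h2 : o.symm x = i
      · obtain rfl : x = y := by rw [← hoi, ← h2]; simp
        simp only [h2, if_false, if_true, lt_irrefl]
        exact ⟨by omega, (hc x).2⟩
      · simp only [h1, h2, if_false]
        exact hc x
  refine ⟨_, List.mem_filter.2 ⟨List.mem_map.2 ⟨i, List.mem_finRange _, rfl⟩, ?_⟩, hcont⟩
  simpa using hcont.isNonempty

theorem joinOneCube_cover (b : ℕ∞) (o : AttrOrder q) {t : Fin q.numAttr → ℤ}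
    (ht : t ∈ joinResult q D) (hc : c.Contains t) :
    (fun x => some (t x)) ∈ (joinOneCube q D b o c).inserted ∨
      ∃ c' ∈ remainder o c (joinOneCube q D b o c).last, c'.Contains t :=
  (joinRec_cover b ht hc (List.nodup_ofFn.2 o.injective) (fun _ => Or.inl rfl)
    (fun y => Or.inl (List.mem_ofFn.2 ⟨o.symm y, by simp⟩)) 0).imp id
    fun h => exists_mem_remainder hc h

theorem mem_attrValues {x : Fin q.numAttr}
    {e : Fin q.numRel} (he : x ∈ q.attrs e) {t : (x : Fin q.numAttr) → x ∈ q.attrs e → ℤ}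
    (ht : t ∈ D e) : t x he ∈ attrValues q D x := by
  rw [attrValues, Finset.mem_biUnion]
  exact ⟨⟨e, he⟩, List.mem_toFinset.2 (mem_relationsWith q x ⟨e, he⟩),
    Finset.mem_image.2 ⟨t, ht, rfl⟩⟩

theorem queryCube_contains_value {x : Fin q.numAttr} {v : ℤ} (h : v ∈ attrValues q D x) :
    (queryCube q D).lo x ≤ v ∧ v ≤ (queryCube q D).hi x := by
  have hne : (attrValues q D x).Nonempty := ⟨v, h⟩
  simp only [queryCube, hne, dif_pos]
  exact ⟨Finset.min'_le _ _ h, Finset.le_max' _ _ h⟩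

theorem queryCube_contains {t : Fin q.numAttr → ℤ} (ht : t ∈ joinResult q D) :
    (queryCube q D).Contains t := by
  intro x
  obtain ⟨e, he⟩ := q.covered x
  exact queryCube_contains_value (mem_attrValues he (ht e))

theorem queryCube_isNonempty (q : JoinQuery) (D : Instance q) : (queryCube q D).IsNonempty := by
  intro x
  by_cases h : (attrValues q D x).Nonempty
  · obtain ⟨v, hv⟩ := h
    exact (queryCube_contains_value hv).1.trans (queryCube_contains_value hv).2
  · simp [queryCube, h]

end OneCube

/-- LFTJ needs at least one iterator operation for each tuple of the result. -/
theorem encard_joinResult_mul_opCost_le_lftjTime (q : JoinQuery) (D : Instance q)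
    (o : AttrOrder q) :
    (joinResult q D).encard * (opCost q D : ℕ∞) ≤ (lftjTime q D o : ℕ∞) := by
  set r := joinOneCube q D ⊤ o (queryCube q D) with hr
  have h1 : (joinResult q D).encard ≤ r.inserted.length := by
    classical
    calc (joinResult q D).encard
        = ((fun (t : Fin q.numAttr → ℤ) x => some (t x)) '' joinResult q D).encard := by
          refine (Function.Injective.encard_image (fun t t' h => ?_) _).symm
          funext x
          simpa using congrFun h x
      _ ≤ ((r.inserted.toFinset : Finset (Assignment q)) : Set (Assignment q)).encard := by
          refine Set.encard_le_encard ?_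
          rintro _ ⟨t, ht, rfl⟩
          have h2 := joinOneCube_cover ⊤ o ht (queryCube_contains ht)
          -- An infinite budget is never exceeded, so nothing remains and every result tuple has
          -- been inserted.
          have h3 : r.last = (queryCube q D).hi := joinOneCube_last.resolve_left (by simp)
          rw [← hr, h3, remainder_hi] at h2
          simpa using h2
      _ ≤ r.inserted.length := by
          rw [Set.encard_coe_eq_coe_finsetCard]
          exact_mod_cast List.toFinset_card_le _
  have h2 : r.inserted.length * opCost q D ≤ lftjTime q D o := joinOneCube_inserted_le
  calc _ ≤ (r.inserted.length : ℕ∞) * (opCost q D : ℕ∞) := by gcongr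
    _ ≤ _ := by exact_mod_cast h2

/-! ### Triejoin of a cube versus triejoin of the query cube -/

section QueryCube

variable (q : JoinQuery) (D : Instance q) (c : Cube q.numAttr)

theorem mem_queryCube_of_mem_trieLevel {q : JoinQuery} {D : Instance q} {M : Assignment q}
    {x : Fin q.numAttr} {e : {e : Fin q.numRel // x ∈ q.attrs e}} {v : ℤ}
    (h : v ∈ trieLevel q D M x e) : (queryCube q D).lo x ≤ v ∧ v ≤ (queryCube q D).hi x := by
  obtain ⟨t, ht, -, rfl⟩ := mem_trieLevel.1 h
  exact queryCube_contains_value (mem_attrValues e.2 ht)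

/-- The query cube excludes no key, so LFTJ runs each leapfrog join to its natural end, as
`paced_of_leapfrog` requires. -/
theorem levelEvents_queryCube (M : Assignment q) (x : Fin q.numAttr) :
    levelEvents q D (queryCube q D) M x =
      leapfrog ((queryCube q D).hi x) ((relationsWith q x).map (trieLevel q D M x)) := by
  rw [levelEvents]
  congr 1
  refine List.map_congr_left fun e _ => ?_
  rw [List.dropWhile_eq_self_iff]
  intro h
  simpa using (mem_queryCube_of_mem_trieLevel (List.getElem_mem h)).1

theorem moveCount_levelEvents_le_queryCube (M : Assignment q) (x : Fin q.numAttr) :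
    moveCount (levelEvents q D c M x) ≤
      (q.numRel + 1) * (2 * moveCount (levelEvents q D (queryCube q D) M x) + 1) := by
  have h1 := moveCount_leapfrog_restrict_le (u := (queryCube q D).hi x) (u' := c.hi x)
    (l := c.lo x) (its := (relationsWith q x).map (trieLevel q D M x))
    (fun it hit => by
      obtain ⟨e, -, rfl⟩ := List.mem_map.1 hit
      exact pairwise_trieLevel q D M x e)
    (fun it hit y hy => by
      obtain ⟨e, -, rfl⟩ := List.mem_map.1 hit
      exact (mem_queryCube_of_mem_trieLevel hy).2)
  rw [List.map_map, List.length_map] at h1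
  rw [levelEvents_queryCube]
  exact h1.trans (Nat.mul_le_mul_right _ (Nat.succ_le_succ (length_relationsWith_le q x)))

theorem sum_map_le_of_subset {α : Type*} {l l' : List α} (hl : l.Nodup) (hl' : l'.Nodup)
    (h : l ⊆ l') (f : α → ℕ) : (l.map f).sum ≤ (l'.map f).sum := by
  classical
  rw [← List.sum_toFinset f hl, ← List.sum_toFinset f hl']
  exact Finset.sum_le_sum_of_subset fun a ha => by
    rw [List.mem_toFinset] at ha ⊢; exact h ha

theorem nodup_eventValues_levelEvents (M : Assignment q) (x : Fin q.numAttr) :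
    (eventValues (levelEvents q D c M x)).Nodup :=
  (pairwise_eventValues_levelEvents q D c M x).imp ne_of_lt

theorem opCost_add_length_le (x : Fin q.numAttr) :
    opCost q D + (relationsWith q x).length ≤ (q.numRel + 1) * opCost q D := by
  have h1 := length_relationsWith_le q x
  have h2 := Nat.le_mul_of_pos_right q.numRel (opCost_pos q D)
  rw [add_mul, one_mul]; omega

/-- Restricting the triejoin to a cube increases its cost by at most a constant factor. -/
theorem triejoinCost_le_queryCube (xs : List (Fin q.numAttr)) (M : Assignment q) :
    triejoinCost q D c xs M ≤
      (1 + 2 * (q.numRel + 1) ^ 2) * triejoinCost q D (queryCube q D) xs M := by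
  induction xs generalizing M with
  | nil => exact Nat.le_mul_of_pos_left _ (by positivity)
  | cons x xs ih =>
    rw [triejoinCost, triejoinCost]
    set R := q.numRel
    set p := opCost q D
    set k := (relationsWith q x).length
    set T := triejoinCost q D (queryCube q D) xs
    set mQ := moveCount (levelEvents q D (queryCube q D) M x)
    have h1 : moveCount (levelEvents q D c M x) ≤ (R + 1) * (2 * mQ + 1) :=
      moveCount_levelEvents_le_queryCube q D c M x
    have h2 : p + k ≤ (R + 1) * p := opCost_add_length_le q D x
    have hk : 1 ≤ k := length_relationsWith_pos q x
    have h3 : ((eventValues (levelEvents q D c M x)).map fun v =>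
        triejoinCost q D c xs (Function.update M x (some v))).sum ≤
        (1 + 2 * (R + 1) ^ 2) * ((eventValues (levelEvents q D (queryCube q D) M x)).map fun v =>
          T (Function.update M x (some v))).sum := by
      rw [← List.sum_map_mul_left]
      refine (List.sum_le_sum fun v _ => ih (Function.update M x (some v))).trans ?_
      refine sum_map_le_of_subset (nodup_eventValues_levelEvents q D c M x)
        (nodup_eventValues_levelEvents q D _ M x) (fun v hv => ?_) _
      rw [mem_eventValues_levelEvents] at hv ⊢
      obtain ⟨e, he⟩ := q.covered x
      have := mem_queryCube_of_mem_trieLevel (hv.2.2 ⟨e, he⟩)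
      exact ⟨this.1, this.2, hv.2.2⟩
    -- The additive constant in the bound on the moves is charged to the cost `3 * k * p` of opening
    -- the level, which is positive because `k ≥ 1`.
    have h4 : (p + k) * moveCount (levelEvents q D c M x) ≤
        2 * (R + 1) ^ 2 * (3 * k * p) + (1 + 2 * (R + 1) ^ 2) * ((p + k) * mQ) := by
      have hp : (R + 1) ^ 2 * p ≤ 2 * (R + 1) ^ 2 * (3 * k * p) := by
        have : 1 * ((R + 1) ^ 2 * p) ≤ (6 * k) * ((R + 1) ^ 2 * p) :=
          Nat.mul_le_mul_right _ (by omega)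
        calc (R + 1) ^ 2 * p = 1 * ((R + 1) ^ 2 * p) := by ring
          _ ≤ _ := this
          _ = _ := by ring
      have hm : 2 * (R + 1) * ((p + k) * mQ) ≤ (1 + 2 * (R + 1) ^ 2) * ((p + k) * mQ) :=
        Nat.mul_le_mul_right _ (by nlinarith)
      calc (p + k) * moveCount (levelEvents q D c M x)
          ≤ (p + k) * ((R + 1) * (2 * mQ + 1)) := Nat.mul_le_mul_left _ h1
        _ = 2 * (R + 1) * ((p + k) * mQ) + (R + 1) * (p + k) := by ring
        _ ≤ 2 * (R + 1) * ((p + k) * mQ) + (R + 1) * ((R + 1) * p) := by gcongr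
        _ = 2 * (R + 1) * ((p + k) * mQ) + (R + 1) ^ 2 * p := by ring
        _ ≤ _ := by omega
    calc _ ≤ 3 * k * p + (2 * (R + 1) ^ 2 * (3 * k * p) + (1 + 2 * (R + 1) ^ 2) * ((p + k) * mQ) +
          (1 + 2 * (R + 1) ^ 2) * ((eventValues (levelEvents q D (queryCube q D) M x)).map fun v =>
          T (Function.update M x (some v))).sum) := by gcongr
      _ = _ := by ring

theorem joinOneCube_steps_le_lftjTime (b : ℕ∞) (o : AttrOrder q) :
    (joinOneCube q D b o c).steps ≤ (1 + 2 * (q.numRel + 1) ^ 2) * lftjTime q D o := by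
  refine joinOneCube_steps_le.trans ?_
  rw [lftjTime, joinOneCube, joinOneCube, joinRec_steps_top, joinRec_steps_top, zero_add, zero_add]
  exact triejoinCost_le_queryCube q D c _ _

end QueryCube

/-! ### Worst-case optimality of the triejoin -/

section WorstCase

variable {q : JoinQuery} {D : Instance q} {c : Cube q.numAttr}

/-- The trie nodes reached from the node `M` by fixing the given attributes. -/
def trieNodes (q : JoinQuery) (D : Instance q) (c : Cube q.numAttr) :
    List (Fin q.numAttr) → Assignment q → List (Assignment q)
  | [], M => [M]
  | x :: xs, M => (eventValues (levelEvents q D c M x)).flatMap fun v =>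
      trieNodes q D c xs (Function.update M x (some v))

theorem trieNodes_append (l l' : List (Fin q.numAttr)) (M : Assignment q) :
    trieNodes q D c (l ++ l') M = (trieNodes q D c l M).flatMap (trieNodes q D c l') := by
  induction l generalizing M with
  | nil => simp [trieNodes]
  | cons x xs ih =>
    rw [List.cons_append, trieNodes, trieNodes, List.flatMap_assoc]
    congr 1
    funext v
    exact ih _

/-- The definition recurses from the root; the arguments below go by the last attribute fixed. -/
theorem trieNodes_concat (l : List (Fin q.numAttr)) (x : Fin q.numAttr) (M : Assignment q) :
    trieNodes q D c (l ++ [x]) M = (trieNodes q D c l M).flatMap fun M' =>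
      (eventValues (levelEvents q D c M' x)).map fun v => Function.update M' x (some v) := by
  rw [trieNodes_append]
  congr 1
  funext M'
  simp only [trieNodes]
  rw [List.map_eq_flatMap]

/-- A relation that misses the newest attribute keeps its old witness tuple, and one that contains
it gets a tuple from its trie level. Nothing is claimed for relations disjoint from `l`: they may be
empty. -/
theorem trieNodes_spec (l : List (Fin q.numAttr)) :
    ∀ M ∈ trieNodes q D c l fun _ => none, (∀ x, M x ≠ none ↔ x ∈ l) ∧
      ∀ e, (∃ x ∈ l, x ∈ q.attrs e) →
        ∃ t ∈ D e, ∀ y, ∀ h : y ∈ q.attrs e, M y = none ∨ M y = some (t y h) := by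
  induction l using List.reverseRecOn with
  | nil =>
    intro M hM
    obtain rfl := List.mem_singleton.1 hM
    simp
  | append_singleton l x ih =>
    intro M hM
    rw [trieNodes_concat, List.mem_flatMap] at hM
    obtain ⟨M', hM', hM⟩ := hM
    obtain ⟨v, hv, rfl⟩ := List.mem_map.1 hM
    obtain ⟨h1, h2⟩ := ih M' hM'
    rw [mem_eventValues_levelEvents] at hv
    refine ⟨fun y => ?_, fun e he => ?_⟩
    · by_cases hy : y = x
      · subst hy; simp
      · rw [Function.update_of_ne hy, h1]; simp [hy]
    · by_cases hx : x ∈ q.attrs e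
      · obtain ⟨t, ht, h3, h4⟩ := mem_trieLevel.1 (hv.2.2 ⟨e, hx⟩)
        refine ⟨t, ht, fun y hy => ?_⟩
        by_cases hyx : y = x
        · subst hyx; simp [h4]
        · rw [Function.update_of_ne hyx]; exact h3 y hy
      · obtain ⟨z, hz, hze⟩ := he
        have hzx : z ≠ x := by rintro rfl; exact hx hze
        obtain ⟨t, ht, h3⟩ := h2 e ⟨z, by simpa [hzx] using hz, hze⟩
        refine ⟨t, ht, fun y hy => ?_⟩
        rw [Function.update_of_ne (by rintro rfl; exact hx hy)]
        exact h3 y hy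

theorem nodup_trieNodes {l : List (Fin q.numAttr)} (hl : l.Nodup) :
    (trieNodes q D c l fun _ => none).Nodup := by
  induction l using List.reverseRecOn with
  | nil => exact List.nodup_singleton _
  | append_singleton l x ih =>
    have hx : x ∉ l := fun h => by
      rw [List.nodup_append] at hl
      exact hl.2.2 x h x (by simp) rfl
    have hnone : ∀ M ∈ trieNodes q D c l fun _ => none, M x = none := by
      intro M hM
      by_contra h
      exact hx (((trieNodes_spec l M hM).1 x).1 h)
    rw [trieNodes_concat, List.nodup_flatMap]
    refine ⟨fun M _ => (nodup_eventValues_levelEvents q D c M x).map fun v v' h => ?_,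
      (ih hl.of_append_left).imp_of_mem fun {M M'} hM hM' hne => ?_⟩
    · simpa using congrFun h x
    · intro a ha ha'
      obtain ⟨v, -, rfl⟩ := List.mem_map.1 ha
      obtain ⟨v', -, h⟩ := List.mem_map.1 ha'
      refine hne (funext fun y => ?_)
      by_cases hy : y = x
      · rw [hy, hnone M hM, hnone M' hM']
      · have := congrFun h y
        rw [Function.update_of_ne hy, Function.update_of_ne hy] at this
        exact this.symm

/-! ### The rank instance: trie levels against the worst-case output -/

theorem trieLevel_congr {M M' : Assignment q} {x : Fin q.numAttr}
    {e : {e : Fin q.numRel // x ∈ q.attrs e}} (h : ∀ y ∈ q.attrs e.1, M y = M' y) :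
    trieLevel q D M x e = trieLevel q D M' x e := by
  rw [trieLevel, trieLevel]
  congr 2
  refine Finset.filter_congr fun t _ => forall_congr' fun y => forall_congr' fun hy => ?_
  rw [h y hy]

/-- The values of the tuple `t` of relation `e` at the attributes in `l`. -/
def restrictTuple {e : Fin q.numRel} (l : List (Fin q.numAttr))
    (t : (x : Fin q.numAttr) → x ∈ q.attrs e → ℤ) : Assignment q := fun x =>
  if x ∈ l then if h : x ∈ q.attrs e then some (t x h) else none else none

/-- Keep the values at the attributes in `l`, replace the value at `y` by its rank in its trie level, and
the other values by zero. -/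
def rankTuple (D : Instance q) (l : List (Fin q.numAttr)) (y : Fin q.numAttr) (e : Fin q.numRel)
    (t : (x : Fin q.numAttr) → x ∈ q.attrs e → ℤ) : (x : Fin q.numAttr) → x ∈ q.attrs e → ℤ :=
  fun x hx => if x ∈ l then t x hx else if h : x = y then
    ((trieLevel q D (restrictTuple l t) y ⟨e, h ▸ hx⟩).idxOf (t x hx) : ℤ) else 0

/-- The instance of all `rankTuple`s; empty relations are replaced by a single zero tuple. -/
def rankInstance (D : Instance q) (l : List (Fin q.numAttr)) (y : Fin q.numAttr) : Instance q :=
  fun e => if D e = ∅ then {fun _ _ => 0} else (D e).image (rankTuple D l y e)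

theorem sizeAtMost_rankInstance {N : Fin q.numRel → ℕ} (hN : ∀ e, 1 ≤ N e)
    (hD : SizeAtMost q N D) (l : List (Fin q.numAttr)) (y : Fin q.numAttr) :
    SizeAtMost q N (rankInstance D l y) := by
  intro e
  rw [rankInstance]
  split_ifs with h
  · simpa using hN e
  · exact Finset.card_image_le.trans (hD e)

/-- Extend a trie node for the attributes in `l` by the value `r` for `y`, and by zeros. -/
def extendNode (l : List (Fin q.numAttr)) (y : Fin q.numAttr) (M : Assignment q) (r : ℕ) :
    Fin q.numAttr → ℤ :=
  fun x => if x ∈ l then (M x).getD 0 else if x = y then r else 0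

/-- Different relations may have different keys at `y` under the same node, but each has an `r`-th
one; after passing to ranks these agree. Relations without `y` contribute any tuple consistent with
the node. -/
theorem extendNode_mem_joinResult {l : List (Fin q.numAttr)} {y : Fin q.numAttr} (hy : y ∉ l)
    {M : Assignment q} (hM : M ∈ trieNodes q D c l fun _ => none) {r : ℕ}
    (hr : ∀ e, r < (trieLevel q D M y e).length) :
    extendNode l y M r ∈ joinResult q (rankInstance D l y) := by
  intro e
  obtain ⟨hdom, hex⟩ := trieNodes_spec l M hM
  rw [rankInstance]
  split_ifs with hDe
  -- An empty relation contains neither `y` nor an attribute of `l`, since both would provide a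
  -- tuple. So the extended node is zero on all of its attributes.
  · rw [Finset.mem_singleton]
    funext x hx
    rw [extendNode, if_neg, if_neg]
    · rintro rfl
      have h1 := hr ⟨e, hx⟩
      obtain ⟨t, ht, -⟩ := mem_trieLevel.1 (List.getElem_mem h1)
      simp [hDe] at ht
    · intro hxl
      obtain ⟨t, ht, -⟩ := hex e ⟨x, hxl, hx⟩
      simp [hDe] at ht
  · rw [Finset.mem_image]
    have hval : ∀ {t : (x : Fin q.numAttr) → x ∈ q.attrs e → ℤ},
        (∀ z, ∀ h : z ∈ q.attrs e, M z = none ∨ M z = some (t z h)) →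
        ∀ z ∈ l, ∀ h : z ∈ q.attrs e, M z = some (t z h) :=
      fun ht z hz h => (ht z h).resolve_left ((hdom z).2 hz)
    by_cases hye : y ∈ q.attrs e
    · obtain ⟨t, ht, hag, hty⟩ := mem_trieLevel.1 (List.getElem_mem (hr ⟨e, hye⟩))
      refine ⟨t, ht, ?_⟩
      funext x hx
      rw [rankTuple, extendNode]
      split_ifs with h1 h2
      · rw [hval hag x h1 hx]; rfl
      · subst h2
        -- The rank of `t` is taken in the level below its own prefix, which is the prefix of the
        -- node `M`.
        have h3 : trieLevel q D (restrictTuple l t) x ⟨e, hx⟩ = trieLevel q D M x ⟨e, hx⟩ := by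
          refine trieLevel_congr fun z hz => ?_
          rw [restrictTuple]
          split_ifs with h4
          · rw [hval hag z h4 hz]
          · by_contra h5
            exact h4 ((hdom z).1 (Ne.symm h5))
        rw [h3, hty, List.Nodup.idxOf_getElem ((pairwise_trieLevel q D M x ⟨e, hx⟩).imp ne_of_lt)]
      · rfl
    · obtain ⟨t, ht, hag⟩ : ∃ t ∈ D e, ∀ z ∈ l, ∀ h : z ∈ q.attrs e, M z = some (t z h) := by
        by_cases h : ∃ x ∈ l, x ∈ q.attrs e
        · obtain ⟨t, ht, hag⟩ := hex e h
          exact ⟨t, ht, hval hag⟩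
        · obtain ⟨t, ht⟩ := Finset.nonempty_iff_ne_empty.2 hDe
          exact ⟨t, ht, fun z hz hze => absurd ⟨z, hz, hze⟩ h⟩
      refine ⟨t, ht, ?_⟩
      funext x hx
      rw [rankTuple, extendNode]
      split_ifs with h1 h2
      · rw [hag x h1 hx]; rfl
      · exact absurd (h2 ▸ hx) hye
      · rfl

/-- The least length of a trie level, summed over all nodes for the attributes in `l`, is at most the
worst-case output size. -/
theorem sum_trieNodes_le_worstCaseOutput {N : Fin q.numRel → ℕ} (hN : ∀ e, 1 ≤ N e)
    (hD : SizeAtMost q N D) {l : List (Fin q.numAttr)} {y : Fin q.numAttr} (hl : l.Nodup)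
    (hy : y ∉ l) {μ : Assignment q → ℕ} (hμ : ∀ M e, μ M ≤ (trieLevel q D M y e).length) :
    ((((trieNodes q D c l fun _ => none).map μ).sum : ℕ) : ℕ∞) ≤ worstCaseOutput q N := by
  classical
  set S := (trieNodes q D c l fun _ => none).toFinset.sigma fun M => Finset.range (μ M) with hS
  set g : (_ : Assignment q) × ℕ → Fin q.numAttr → ℤ := fun p => extendNode l y p.1 p.2 with hg
  -- The rank is read off at `y` and the node at the attributes of `l`, which are exactly those
  -- where the node has a value.
  have hinj : Set.InjOn g S := by
    rintro ⟨M, r⟩ hp ⟨M', r'⟩ hp' h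
    simp only [hS, Finset.coe_sigma, Set.mem_sigma_iff, Finset.mem_coe, List.mem_toFinset] at hp hp'
    have h1 := trieNodes_spec l M hp.1
    have h2 := trieNodes_spec l M' hp'.1
    have hr : r = r' := by
      have := congrFun h y
      simpa [hg, extendNode, hy] using this
    have hM : M = M' := by
      funext x
      by_cases hx : x ∈ l
      · obtain ⟨a, ha⟩ := Option.ne_none_iff_exists'.1 ((h1.1 x).2 hx)
        obtain ⟨a', ha'⟩ := Option.ne_none_iff_exists'.1 ((h2.1 x).2 hx)
        have := congrFun h x
        simpa [hg, extendNode, hx, ha, ha'] using this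
      · rw [not_not.1 (mt (h1.1 x).1 hx), not_not.1 (mt (h2.1 x).1 hx)]
    rw [hr, hM]
  calc ((((trieNodes q D c l fun _ => none).map μ).sum : ℕ) : ℕ∞)
      = ((S.image g : Finset _) : Set (Fin q.numAttr → ℤ)).encard := by
        rw [Set.encard_coe_eq_coe_finsetCard, Finset.card_image_of_injOn hinj, hS,
          Finset.card_sigma, ← List.sum_toFinset _ (nodup_trieNodes hl)]
        simp
    _ ≤ (joinResult q (rankInstance D l y)).encard := by
        refine Set.encard_le_encard fun t ht => ?_
        rw [Finset.mem_coe, Finset.mem_image] at ht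
        obtain ⟨⟨M, r⟩, hp, rfl⟩ := ht
        rw [hS, Finset.mem_sigma, List.mem_toFinset, Finset.mem_range] at hp
        exact extendNode_mem_joinResult hy hp.1 fun e => hp.2.trans_le (hμ M e)
    _ ≤ worstCaseOutput q N :=
        le_iSup₂_of_le _ (sizeAtMost_rankInstance hN hD l y) le_rfl

theorem one_le_worstCaseOutput {N : Fin q.numRel → ℕ} (hN : ∀ e, 1 ≤ N e) :
    1 ≤ worstCaseOutput q N := by
  refine le_iSup₂_of_le (fun _ => {fun _ _ => 0}) (fun e => by simpa using hN e) ?_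
  rw [Set.one_le_encard_iff_nonempty]
  exact ⟨fun _ => 0, fun e => by simp⟩

/-! ### Cost per trie node and summation over the levels -/

theorem exists_least_level (q : JoinQuery) (D : Instance q) (M : Assignment q)
    (y : Fin q.numAttr) :
    ∃ k, (∀ e, k ≤ (trieLevel q D M y e).length) ∧ ∃ e, (trieLevel q D M y e).length = k := by
  obtain ⟨e, he⟩ := q.covered y
  obtain ⟨e', -, h⟩ := Finset.exists_min_image Finset.univ
    (fun e => (trieLevel q D M y e).length) ⟨⟨e, he⟩, Finset.mem_univ _⟩
  exact ⟨_, fun e => h e (Finset.mem_univ e), e', rfl⟩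

/-- The least length of a trie level for attribute `y` at the node `M`. -/
noncomputable def leastLevel (q : JoinQuery) (D : Instance q) (y : Fin q.numAttr)
    (M : Assignment q) : ℕ := (exists_least_level q D M y).choose

theorem leastLevel_le (y : Fin q.numAttr) (M : Assignment q)
    (e : {e : Fin q.numRel // y ∈ q.attrs e}) :
    leastLevel q D y M ≤ (trieLevel q D M y e).length :=
  (exists_least_level q D M y).choose_spec.1 e

theorem exists_length_eq_leastLevel (q : JoinQuery) (D : Instance q) (y : Fin q.numAttr)
    (M : Assignment q) : ∃ e, (trieLevel q D M y e).length = leastLevel q D y M :=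
  (exists_least_level q D M y).choose_spec.2

theorem moveCount_levelEvents_le (y : Fin q.numAttr) (M : Assignment q) :
    moveCount (levelEvents q D c M y) ≤ (q.numRel + 1) * (2 * leastLevel q D y M + 1) := by
  obtain ⟨e, he⟩ := exists_length_eq_leastLevel q D y M
  refine (moveCount_leapfrog_le (allIncreasing_level q D M y (c.lo y))
    (List.mem_map.2 ⟨e, mem_relationsWith q y e, rfl⟩)).trans ?_
  have h1 := (List.dropWhile_sublist (fun w => decide (w < c.lo y))
    (l := trieLevel q D M y e)).length_le
  rw [List.length_map]
  exact Nat.mul_le_mul (Nat.succ_le_succ (length_relationsWith_le q y)) (by omega)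

theorem length_eventValues_levelEvents_le (y : Fin q.numAttr) (M : Assignment q) :
    (eventValues (levelEvents q D c M y)).length ≤ leastLevel q D y M := by
  obtain ⟨e, he⟩ := exists_length_eq_leastLevel q D y M
  rw [← he]
  exact ((nodup_eventValues_levelEvents q D c M y).subperm fun v hv =>
    (mem_eventValues_levelEvents.1 hv).2.2 e).length_le

/-- A node has at most as many children as its shortest trie level has keys, so the previous sum
bounds the next depth. The root alone needs `Q* ≥ 1`, which is where nonzero size bounds enter. -/
theorem length_trieNodes_le_worstCaseOutput {N : Fin q.numRel → ℕ} (hN : ∀ e, 1 ≤ N e)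
    (hD : SizeAtMost q N D) {l : List (Fin q.numAttr)} (hl : l.Nodup) :
    ((trieNodes q D c l fun _ => none).length : ℕ∞) ≤ worstCaseOutput q N := by
  induction l using List.reverseRecOn with
  | nil => simpa [trieNodes] using one_le_worstCaseOutput hN
  | append_singleton l x _ =>
    have hx : x ∉ l := fun h => by
      rw [List.nodup_append] at hl
      exact hl.2.2 x h x (by simp) rfl
    refine le_trans ?_ (sum_trieNodes_le_worstCaseOutput (c := c) hN hD hl.of_append_left hx
      (leastLevel_le x))
    rw [trieNodes_concat, List.length_flatMap]
    refine Nat.cast_le.2 (List.sum_le_sum fun M _ => ?_)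
    rw [List.length_map]
    exact length_eventValues_levelEvents_le x M

/-- The cost of a triejoin is the sum over all levels of the cost of the nodes. -/
theorem sum_triejoinCost_le {B : ℕ} {M₀ : Assignment q} (suf pre : List (Fin q.numAttr))
    (h : ∀ l y l', pre ++ suf = l ++ y :: l' →
      ((trieNodes q D c l M₀).map fun M => 3 * (relationsWith q y).length * opCost q D +
        (opCost q D + (relationsWith q y).length) * moveCount (levelEvents q D c M y)).sum ≤ B)
    (h' : (trieNodes q D c (pre ++ suf) M₀).length * q.numAttr ≤ B) :
    ((trieNodes q D c pre M₀).map (triejoinCost q D c suf)).sum ≤ (suf.length + 1) * B := by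
  induction suf generalizing pre with
  | nil =>
    rw [List.append_nil] at h'
    have : triejoinCost q D c [] = fun _ => q.numAttr := rfl
    simpa [this] using h'
  | cons y suf ih =>
    have h1 := ih (pre ++ [y]) (by simpa using h) (by simpa using h')
    have h2 := h pre y suf rfl
    rw [trieNodes_concat, List.map_flatMap, List.flatMap_def, List.sum_flatten] at h1
    simp only [List.map_map] at h1
    have h3 : ((trieNodes q D c pre M₀).map (triejoinCost q D c (y :: suf))).sum =
        ((trieNodes q D c pre M₀).map fun M => 3 * (relationsWith q y).length * opCost q D +
          (opCost q D + (relationsWith q y).length) * moveCount (levelEvents q D c M y)).sum +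
        ((trieNodes q D c pre M₀).map fun M' => ((eventValues (levelEvents q D c M' y)).map
          (triejoinCost q D c suf ∘ fun v => Function.update M' y (some v))).sum).sum := by
      rw [← List.sum_map_add]
      congr 1
      refine List.map_congr_left fun M _ => ?_
      rw [triejoinCost, add_assoc]
      rfl
    rw [h3, List.length_cons]
    calc _ ≤ B + (suf.length + 1) * B := add_le_add h2 h1
      _ = _ := by ring

/-- LFTJ is worst-case optimal up to a logarithmic factor. -/
theorem lftjTime_le_worstCaseOutput {N : Fin q.numRel → ℕ} (hN : ∀ e, 1 ≤ N e)
    (hD : SizeAtMost q N D) (o : AttrOrder q) {Q : ℕ} (hQ : worstCaseOutput q N = Q) :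
    lftjTime q D o ≤ (q.numAttr + 1) * (3 * q.numRel + 3 * (q.numRel + 1) ^ 2 + q.numAttr) *
      (Q * opCost q D) := by
  set R := q.numRel with hR
  set p := opCost q D with hp
  have hnd : (List.ofFn o).Nodup := List.nodup_ofFn.2 o.injective
  have hB := sum_triejoinCost_le (D := D) (c := queryCube q D) (M₀ := fun _ => none)
    (B := (3 * R + 3 * (R + 1) ^ 2 + q.numAttr) * (Q * p)) (List.ofFn o) [] ?_ ?_
  · rw [lftjTime, joinOneCube, joinRec_steps_top, zero_add, mul_assoc]
    simpa [trieNodes] using hB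
  · intro l y l' hl
    rw [List.nil_append] at hl
    rw [hl, List.nodup_append] at hnd
    have hy : y ∉ l := fun h => hnd.2.2 y h y (by simp) rfl
    have h1 : (trieNodes q D (queryCube q D) l fun _ => none).length ≤ Q := by
      have := length_trieNodes_le_worstCaseOutput (c := queryCube q D) hN hD hnd.1
      rw [hQ] at this
      exact_mod_cast this
    have h2 : ((trieNodes q D (queryCube q D) l fun _ => none).map (leastLevel q D y)).sum ≤ Q := by
      have := sum_trieNodes_le_worstCaseOutput (c := queryCube q D) hN hD hnd.1 hy (leastLevel_le y)
      rw [hQ] at this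
      exact_mod_cast this
    -- The part of the cost that is constant per node is summed by the number of nodes, the rest by
    -- the shortest trie levels; both sums are at most `Q`.
    calc _ ≤ ((trieNodes q D (queryCube q D) l fun _ => none).map fun M =>
            ((3 * R + (R + 1) ^ 2) * p + 2 * (R + 1) ^ 2 * p * leastLevel q D y M)).sum := by
          refine List.sum_le_sum fun M _ => ?_
          calc _ ≤ 3 * R * p + ((R + 1) * p) * ((R + 1) * (2 * leastLevel q D y M + 1)) := by
                gcongr
                · exact length_relationsWith_le q y
                · exact opCost_add_length_le q D y
                · exact moveCount_levelEvents_le y M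
            _ = _ := by ring
      _ = (trieNodes q D (queryCube q D) l fun _ => none).length * ((3 * R + (R + 1) ^ 2) * p) +
          2 * (R + 1) ^ 2 * p *
            ((trieNodes q D (queryCube q D) l fun _ => none).map (leastLevel q D y)).sum := by
          rw [List.sum_map_add, List.map_const', List.sum_replicate, smul_eq_mul,
            List.sum_map_mul_left]
      _ ≤ Q * ((3 * R + (R + 1) ^ 2) * p) + 2 * (R + 1) ^ 2 * p * Q := by gcongr
      _ = (3 * R + 3 * (R + 1) ^ 2) * (Q * p) := by ring
      _ ≤ _ := Nat.mul_le_mul_right _ (Nat.le_add_right _ _)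
  · have h1 : (trieNodes q D (queryCube q D) (List.ofFn o) fun _ => none).length ≤ Q := by
      have := length_trieNodes_le_worstCaseOutput (c := queryCube q D) hN hD hnd
      rw [hQ] at this
      exact_mod_cast this
    have h2 : 1 ≤ p := opCost_pos q D
    calc _ ≤ Q * q.numAttr := Nat.mul_le_mul_right _ h1
      _ = q.numAttr * (Q * 1) := by ring
      _ ≤ q.numAttr * (Q * p) := by gcongr
      _ ≤ _ := Nat.mul_le_mul_right _ (Nat.le_add_left _ _)

end WorstCase

/-! ### The initial cubes -/

/-- The shares are consecutive intervals from `0` to `n * w / n = w`. If none contained `d`, then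
`d` would lie beyond each endpoint in turn, including `w`. -/
theorem exists_share {w d : ℤ} {n : ℕ} (hn : 1 ≤ n) (hd : 0 ≤ d) (hdw : d < w) :
    ∃ i < n, (i : ℤ) * w / n ≤ d ∧ d < ((i : ℤ) + 1) * w / n := by
  by_contra! h
  have key : ∀ i : ℕ, i ≤ n → (i : ℤ) * w / n ≤ d := by
    intro i
    induction i with
    | zero => intro _; simpa using hd
    | succ i ih =>
      intro hi
      push_cast
      exact h i (by omega) (ih (by omega))
  have h1 := key n le_rfl
  rw [Int.mul_ediv_cancel_left w (by omega)] at h1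
  omega

theorem exists_mem_initialCubes {m : ℕ} {c : Cube m} {t : Fin m → ℤ} (hc : c.Contains t)
    (a : Fin m) {n : ℕ} (hn : 1 ≤ n) : ∃ c' ∈ initialCubes c a n, c'.Contains t := by
  obtain ⟨i, hi, h1, h2⟩ := exists_share (w := c.hi a - c.lo a + 1) (d := t a - c.lo a) hn
    (by linarith [(hc a).1]) (by linarith [(hc a).2])
  have hcont : (c.share a n i).Contains t := by
    intro x
    by_cases hx : x = a
    · subst hx
      simp only [Cube.share, Function.update_self]
      constructor <;> linarith
    · simp only [Cube.share, Function.update_of_ne hx]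
      exact hc x
  refine ⟨_, List.mem_filter.2 ⟨List.mem_map.2 ⟨i, List.mem_range.2 hi, rfl⟩, ?_⟩, hcont⟩
  simpa using hcont.isNonempty

theorem length_initialCubes_le {m : ℕ} (c : Cube m) (a : Fin m) (n : ℕ) :
    (initialCubes c a n).length ≤ n :=
  (List.length_filter_le _ _).trans (by simp)

theorem initialCubes_ne_nil {m : ℕ} {c : Cube m} (hc : c.IsNonempty) (a : Fin m) {n : ℕ}
    (hn : 1 ≤ n) : initialCubes c a n ≠ [] := by
  obtain ⟨c', hc', -⟩ := exists_mem_initialCubes (t := c.lo) (fun x => ⟨le_rfl, hc x⟩) a hn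
  exact List.ne_nil_of_mem hc'

/-! ### Upper bound on the time of a run -/

section Potential

variable {q : JoinQuery} {D : Instance q} {n : ℕ} {o : AttrOrder q}

theorem sum_update_update {ι α β : Type*} [Fintype ι] [DecidableEq ι] (g : α → β → ℕ) (f : ι → α)
    (h : ι → β) (i : ι) (a : α) (b : β) :
    ∑ j, g (Function.update f i a j) (Function.update h i b j) + g (f i) (h i) =
      ∑ j, g (f j) (h j) + g a b := by
  rw [← Finset.add_sum_erase _ _ (Finset.mem_univ i),
    ← Finset.add_sum_erase _ (fun j => g (f j) (h j)) (Finset.mem_univ i)]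
  have : ∑ j ∈ Finset.univ.erase i, g (Function.update f i a j) (Function.update h i b j) =
      ∑ j ∈ Finset.univ.erase i, g (f j) (h j) := by
    refine Finset.sum_congr rfl fun j hj => ?_
    rw [Function.update_of_ne (Finset.ne_of_mem_erase hj),
      Function.update_of_ne (Finset.ne_of_mem_erase hj)]
  rw [this]
  simp only [Function.update_self]
  omega

/-- The future cost of a thread: `W` for a target cube, and `V` if its budget is not used up. -/
def threadPotential {m : ℕ} (W V : ℕ) (b : ℕ) (c : Option (Cube m)) : ℕ :=
  (if c = none then 0 else W) + if b = 0 then 0 else V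

/-- The time spent plus the future cost, except for the cost of further episodes, if a join costs at
most `W`. -/
def potential (W V : ℕ) (σ : EpisodeState q n) : ℕ :=
  σ.sys.time + σ.sys.unprocessed.card * (q.numAttr + W) +
    ∑ t, threadPotential W V (σ.budget t) (σ.target t)

/-- Only threads with budget left have a target cube. -/
def TargetsHaveBudget (σ : EpisodeState q n) : Prop :=
  ∀ t, σ.target t ≠ none → σ.budget t ≠ 0

/-- `W` bounds a join with its overhead, and a waiting cube carries `q.numAttr + W` for its
retrieval and join. A thread with budget holds `V`, enough for the at most `q.numAttr` cubes of its
one timeout, with one more step for becoming idle. The invariant `TargetsHaveBudget` guarantees that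
a joining thread still holds its `V`. -/
theorem ThreadStep.potential_le {B : ℕ}
    (hB : ∀ (b : ℕ∞) (c : Cube q.numAttr), (joinOneCube q D b o c).steps ≤ B)
    {σ τ : EpisodeState q n} (h : ThreadStep q D o n σ τ) (hσ : TargetsHaveBudget σ) :
    TargetsHaveBudget τ ∧
      potential (B + 3 * q.numAttr ^ 2) (q.numAttr * (q.numAttr + (B + 3 * q.numAttr ^ 2)) + 1) τ ≤
      potential (B + 3 * q.numAttr ^ 2)
        (q.numAttr * (q.numAttr + (B + 3 * q.numAttr ^ 2)) + 1) σ := by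
  set W := B + 3 * q.numAttr ^ 2 with hW
  set V := q.numAttr * (q.numAttr + W) + 1 with hV
  cases h with
  | retrieve t c U hbudget hfree hc =>
    constructor
    · intro t' ht'
      by_cases h : t' = t
      · subst h; exact hbudget.ne'
      · exact hσ t' (by simpa [Function.update_of_ne h] using ht')
    · have h1 := sum_update_update (threadPotential W V) σ.budget σ.target t (σ.budget t) (some c)
      rw [Function.update_eq_self] at h1
      simp only [potential, hc, Multiset.card_cons, add_mul, one_mul]
      simp only [threadPotential, hfree, if_true, reduceCtorEq, if_false] at h1 ⊢
      omega
  | join t c r hc hr =>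
    subst hr
    set r := joinOneCube q D (σ.budget t : ℕ∞) o c with hr
    constructor
    · intro t' ht'
      by_cases h : t' = t
      · subst h; simp at ht'
      · simp only [Function.update_of_ne h] at ht' ⊢
        exact hσ t' ht'
    · have h1 := sum_update_update (threadPotential W V) σ.budget σ.target t
        (σ.budget t - r.steps) none
      have h2 : r.steps ≤ B := hB _ _
      have h3 := hσ t (by simp [hc])
      simp only [potential, Multiset.card_add, Multiset.coe_card, add_mul]
      simp only [threadPotential, hc, if_true, reduceCtorEq, if_false, h3] at h1 ⊢
      -- After a timeout the budget is zero and the released `V` pays for the remaining cubes;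
      -- otherwise there are none and `V` may be kept.
      rcases (joinOneCube_last : (σ.budget t : ℕ∞) < (r.steps : ℕ∞) ∨ r.last = c.hi) with h4 | h4
      · have h5 : σ.budget t < r.steps := by exact_mod_cast h4
        rw [Nat.sub_eq_zero_of_le h5.le] at h1 ⊢
        have h6 : (remainder o c r.last).length * (q.numAttr + W) ≤
            q.numAttr * (q.numAttr + W) := Nat.mul_le_mul_right _ (length_remainder_le o c _)
        simp only [if_true] at h1 ⊢
        omega
      · rw [h4, remainder_hi, List.length_nil, zero_mul]
        have h5 : (if σ.budget t - r.steps = 0 then 0 else V) ≤ V := by split_ifs <;> omega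
        omega
  | idle t hbudget hfree hU =>
    constructor
    · intro t' ht'
      by_cases h : t' = t
      · subst h; exact absurd hfree ht'
      · simp only [Function.update_of_ne h]
        exact hσ t' ht'
    · have h1 := sum_update_update (threadPotential W V) σ.budget σ.target t 0 (σ.target t)
      rw [Function.update_eq_self] at h1
      simp only [potential]
      simp only [threadPotential, hfree, if_true, hbudget.ne', if_false] at h1 ⊢
      omega

theorem Episode.time_le {B b : ℕ}
    (hB : ∀ (b : ℕ∞) (c : Cube q.numAttr), (joinOneCube q D b o c).steps ≤ B)
    {σ τ : SystemState q} (h : Episode q D n b o σ τ) :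
    τ.time + τ.unprocessed.card * (q.numAttr + (B + 3 * q.numAttr ^ 2)) ≤
      σ.time + σ.unprocessed.card * (q.numAttr + (B + 3 * q.numAttr ^ 2)) +
        (q.numAttr ^ 2 + q.numAttr +
          n * (q.numAttr * (q.numAttr + (B + 3 * q.numAttr ^ 2)) + 1)) := by
  obtain ⟨ρ, hρ, -, -, rfl⟩ := h
  set W := B + 3 * q.numAttr ^ 2 with hW
  set V := q.numAttr * (q.numAttr + W) + 1 with hV
  set σ₀ : EpisodeState q n :=
    { sys := { σ with time := σ.time + q.numAttr ^ 2 + q.numAttr }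
      budget := fun _ => b
      target := fun _ => none } with hσ₀
  have h1 : TargetsHaveBudget ρ ∧ potential W V ρ ≤ potential W V σ₀ := by
    induction hρ with
    | refl => exact ⟨fun t ht => absurd rfl ht, le_rfl⟩
    | tail _ hstep ih =>
      have := hstep.potential_le hB ih.1
      exact ⟨this.1, this.2.trans ih.2⟩
  have h2 : ∑ t, threadPotential W V (σ₀.budget t) (σ₀.target t) ≤ n * V := by
    refine (Finset.sum_le_card_nsmul _ _ V fun t _ => ?_).trans (by simp)
    rw [threadPotential, hσ₀]
    split_ifs <;> simp_all
  have h3 := h1.2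
  simp only [potential] at h3
  have h4 : σ₀.sys.time = σ.time + q.numAttr ^ 2 + q.numAttr := rfl
  have h5 : σ₀.sys.unprocessed = σ.unprocessed := rfl
  rw [h4, h5] at h3
  omega

theorem Run.time_le {B b : ℕ} {os : List (AttrOrder q)} {σ : SystemState q}
    (h : Run q D n b os σ)
    (hB : ∀ o ∈ os, ∀ (b : ℕ∞) (c : Cube q.numAttr), (joinOneCube q D b o c).steps ≤ B) :
    σ.time + σ.unprocessed.card * (q.numAttr + (B + 3 * q.numAttr ^ 2)) ≤
      n * q.numAttr + n * (q.numAttr + (B + 3 * q.numAttr ^ 2)) +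
        os.length * (q.numAttr ^ 2 + q.numAttr +
          n * (q.numAttr * (q.numAttr + (B + 3 * q.numAttr ^ 2)) + 1)) := by
  induction h with
  | init a ha =>
    dsimp only
    rw [Multiset.coe_card]
    have := Nat.mul_le_mul_right (q.numAttr + (B + 3 * q.numAttr ^ 2))
      (length_initialCubes_le (queryCube q D) a n)
    omega
  | episode os σ τ o _ _ hep ih =>
    have h1 := ih fun o' ho' => hB o' (by simp [ho'])
    have h2 := hep.time_le (hB o (by simp))
    rw [List.length_append, List.length_singleton, add_mul, one_mul]
    omega

end Potential

theorem lftjTime_pos (q : JoinQuery) (D : Instance q) (o : AttrOrder q) : 1 ≤ lftjTime q D o := by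
  rw [lftjTime, joinOneCube, joinRec_steps_top, zero_add]
  have := q.numAttr_pos
  cases List.ofFn o with
  | nil => exact this
  | cons x xs =>
    have h1 : 1 * 1 ≤ 3 * (relationsWith q x).length * opCost q D :=
      Nat.mul_le_mul (by have := length_relationsWith_pos q x; omega) (opCost_pos q D)
    rw [triejoinCost]; omega

/-- The factor between the time of ADOPT and that of LFTJ. -/
def adoptFactor (q : JoinQuery) (n E : ℕ) : ℕ :=
  n * q.numAttr + n * (q.numAttr + (1 + 2 * (q.numRel + 1) ^ 2 + 3 * q.numAttr ^ 2)) +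
    E * (q.numAttr ^ 2 + q.numAttr + n *
      (q.numAttr * (q.numAttr + (1 + 2 * (q.numRel + 1) ^ 2 + 3 * q.numAttr ^ 2)) + 1))

/-- The order is the one with the largest LFTJ time among those used: its time bounds the cost of
every join of the run up to a constant factor. -/
theorem Completes.exists_time_le {q : JoinQuery} {D : Instance q} {n E : ℕ} (hn : 1 ≤ n)
    {os : List (AttrOrder q)} {time : ℕ} (h : Completes q D n os time) (hE : os.length ≤ E) :
    ∃ o ∈ os, time ≤ adoptFactor q n E * lftjTime q D o := by
  classical
  obtain ⟨b, σ, hrun, hU, rfl⟩ := h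
  -- The query cube is never empty, so some initial cube exists and at least one episode takes
  -- place.
  have hos : os ≠ [] := by
    rintro rfl
    generalize hos : ([] : List (AttrOrder q)) = os at hrun
    cases hrun with
    | init a ha =>
      rw [Multiset.coe_eq_zero] at hU
      exact initialCubes_ne_nil (queryCube_isNonempty q D) a hn hU
    | episode => simp at hos
  obtain ⟨o, ho, hmax⟩ := Finset.exists_max_image os.toFinset (lftjTime q D)
    (by simpa [Finset.nonempty_iff_ne_empty] using hos)
  rw [List.mem_toFinset] at ho
  refine ⟨o, ho, ?_⟩
  set X := lftjTime q D o
  have hX : 1 ≤ X := lftjTime_pos q D o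
  have h1 := hrun.time_le (B := (1 + 2 * (q.numRel + 1) ^ 2) * X) fun o' ho' b c =>
    (joinOneCube_steps_le_lftjTime q D c b o').trans
      (Nat.mul_le_mul_left _ (hmax o' (List.mem_toFinset.2 ho')))
  rw [adoptFactor]
  set m := q.numAttr
  set K := 1 + 2 * (q.numRel + 1) ^ 2
  -- Since `X ≥ 1`, all overhead independent of the data is absorbed into multiples of `X`.
  have hle : ∀ a : ℕ, a ≤ a * X := fun a => Nat.le_mul_of_pos_right a hX
  have h2 : m + (K * X + 3 * m ^ 2) ≤ (m + (K + 3 * m ^ 2)) * X := by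
    calc _ ≤ m * X + (K * X + 3 * m ^ 2 * X) :=
          add_le_add (hle _) (Nat.add_le_add_left (hle _) _)
      _ = _ := by ring
  have h3 : m * (m + (K * X + 3 * m ^ 2)) + 1 ≤ (m * (m + (K + 3 * m ^ 2)) + 1) * X := by
    calc _ ≤ m * ((m + (K + 3 * m ^ 2)) * X) + X := by gcongr
      _ = _ := by ring
  calc σ.time ≤ n * m + n * (m + (K * X + 3 * m ^ 2)) +
        os.length * (m ^ 2 + m + n * (m * (m + (K * X + 3 * m ^ 2)) + 1)) :=
        (Nat.le_add_right _ _).trans h1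
    _ ≤ n * m * X + n * ((m + (K + 3 * m ^ 2)) * X) +
        E * ((m ^ 2 + m) * X + n * ((m * (m + (K + 3 * m ^ 2)) + 1) * X)) :=
        add_le_add (add_le_add (hle _) (Nat.mul_le_mul_left _ h2))
          (Nat.mul_le_mul hE (add_le_add (hle _) (Nat.mul_le_mul_left _ h3)))
    _ = _ := by ring

/-! ### Lower bound on the time of a run -/

section Coverage

variable {q : JoinQuery} {D : Instance q} {n : ℕ} {o : AttrOrder q}

/-- Each result tuple is in an unprocessed cube, in a target cube or among the results, and each result
found so far has cost an iterator operation. -/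
structure EpisodeState.Covering (D : Instance q) (σ : EpisodeState q n) : Prop where
  covered : ∀ t ∈ joinResult q D, (∃ c ∈ σ.sys.unprocessed, c.Contains t) ∨
    (∃ i c, σ.target i = some c ∧ c.Contains t) ∨ (fun x => some (t x)) ∈ σ.sys.results
  paid : σ.sys.results.encard * (opCost q D : ℕ∞) ≤ σ.sys.time

/-- Only a join can affect the claim. It inserts a result point of its cube or leaves it in a
remaining cube, and its steps pay for the tuples it inserts. -/
theorem ThreadStep.covering {σ τ : EpisodeState q n} (h : ThreadStep q D o n σ τ)
    (hσ : σ.Covering D) : τ.Covering D := by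
  classical
  cases h with
  | retrieve i c U hbudget hfree hc =>
    refine ⟨fun t ht => ?_, hσ.paid.trans (Nat.cast_le.2 (Nat.le_add_right _ _))⟩
    rcases hσ.covered t ht with ⟨c', hc', h⟩ | ⟨j, c', hc', h⟩ | h
    · rw [hc, Multiset.mem_cons] at hc'
      rcases hc' with rfl | hc'
      · exact Or.inr (Or.inl ⟨i, c', by simp, h⟩)
      · exact Or.inl ⟨c', hc', h⟩
    · have hji : j ≠ i := by rintro rfl; simp [hfree] at hc'
      exact Or.inr (Or.inl ⟨j, c', by simp [Function.update_of_ne hji, hc'], h⟩)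
    · exact Or.inr (Or.inr h)
  | join i c r hc hr =>
    refine ⟨fun t ht => ?_, ?_⟩
    · rcases hσ.covered t ht with ⟨c', hc', h⟩ | ⟨j, c', hc', h⟩ | h
      · exact Or.inl ⟨c', Multiset.mem_add.2 (Or.inl hc'), h⟩
      · by_cases hji : j = i
        · subst hji
          obtain rfl : c = c' := by simpa [hc] using hc'
          rcases joinOneCube_cover (σ.budget j : ℕ∞) o ht h with h1 | ⟨c', h1, h2⟩
          · exact Or.inr (Or.inr (Or.inr (hr ▸ h1)))
          · exact Or.inl ⟨c', Multiset.mem_add.2 (Or.inr (hr ▸ h1)), h2⟩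
        · exact Or.inr (Or.inl ⟨j, c', by simp [Function.update_of_ne hji, hc'], h⟩)
      · exact Or.inr (Or.inr (Or.inl h))
    · dsimp only
      have h1 : r.inserted.length * opCost q D ≤ r.steps := hr ▸ joinOneCube_inserted_le
      have h2 : {M | M ∈ r.inserted}.encard ≤ (r.inserted.length : ℕ∞) := by
        have h3 : {M | M ∈ r.inserted} = ((r.inserted.toFinset : Finset _) : Set _) := by
          ext; simp
        rw [h3, Set.encard_coe_eq_coe_finsetCard]
        exact_mod_cast List.toFinset_card_le _
      calc _ ≤ (σ.sys.results.encard + r.inserted.length) * (opCost q D : ℕ∞) := by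
            gcongr
            exact (Set.encard_union_le _ _).trans (by gcongr)
        _ = σ.sys.results.encard * (opCost q D : ℕ∞) + (r.inserted.length * opCost q D : ℕ) := by
            rw [add_mul]; push_cast; rfl
        _ ≤ (σ.sys.time : ℕ∞) + (r.steps : ℕ) := by
            gcongr
            exact hσ.paid
        _ ≤ _ := by
            rw [← Nat.cast_add]
            exact Nat.cast_le.2 (Nat.le_add_right _ _)
  | idle i hbudget hfree hU =>
    exact ⟨hσ.covered, hσ.paid.trans (Nat.cast_le.2 (Nat.le_add_right _ _))⟩

/-- Between episodes no thread holds a cube, so a system state counts as an episode state without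
targets; its budgets play no role. -/
theorem Run.covering (hn : 1 ≤ n) {b : ℕ} {os : List (AttrOrder q)} {σ : SystemState q}
    (h : Run q D n b os σ) :
    (⟨σ, fun _ => 0, fun _ => none⟩ : EpisodeState q n).Covering D := by
  induction h with
  | init a ha =>
    refine ⟨fun t ht => Or.inl ?_, by simp⟩
    obtain ⟨c, hc, h⟩ := exists_mem_initialCubes (queryCube_contains ht) a hn
    exact ⟨c, hc, h⟩
  | episode os σ τ o _ _ hep ih =>
    obtain ⟨ρ, hρ, -, hnone, rfl⟩ := hep
    have h1 : ρ.Covering D := by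
      clear hnone
      induction hρ with
      | refl =>
        exact ⟨ih.covered, ih.paid.trans
          (Nat.cast_le.2 ((Nat.le_add_right _ _).trans (Nat.le_add_right _ _)))⟩
      | tail _ hstep ih' => exact hstep.covering ih'
    have h2 : ρ.target = fun _ => none := funext hnone
    exact ⟨by simpa only [h2] using h1.covered, h1.paid⟩

/-- ADOPT needs at least one iterator operation for each tuple of the result. -/
theorem Completes.encard_joinResult_mul_opCost_le (hn : 1 ≤ n) {os : List (AttrOrder q)} {time : ℕ}
    (h : Completes q D n os time) :
    (joinResult q D).encard * (opCost q D : ℕ∞) ≤ time := by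
  obtain ⟨b, σ, hrun, hU, rfl⟩ := h
  have h1 := hrun.covering hn
  refine le_trans ?_ h1.paid
  gcongr
  calc (joinResult q D).encard
      = ((fun (t : Fin q.numAttr → ℤ) x => some (t x)) '' joinResult q D).encard := by
        refine (Function.Injective.encard_image (fun t t' h => ?_) _).symm
        funext x
        simpa using congrFun h x
    _ ≤ σ.results.encard := by
        refine Set.encard_le_encard ?_
        rintro _ ⟨t, ht, rfl⟩
        simpa [hU] using h1.covered t ht

end Coverage

/-! ### Existence of complete join phases -/

section Existence

variable {q : JoinQuery} {D : Instance q} {n : ℕ} {o : AttrOrder q}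

/-- A thread with a sufficiently large budget processes all cubes. -/
theorem exists_processed (D : Instance q) (o : AttrOrder q) (i : Fin n)
    (U : List (Cube q.numAttr)) (σ : EpisodeState q n)
    (hU : σ.sys.unprocessed = U) (hfree : ∀ t, σ.target t = none)
    (hb : (U.map fun c => (joinOneCube q D ⊤ o c).steps).sum < σ.budget i) :
    ∃ τ, Relation.ReflTransGen (ThreadStep q D o n) σ τ ∧ τ.sys.unprocessed = 0 ∧
      ∀ t, τ.target t = none := by
  induction U generalizing σ with
  | nil => exact ⟨σ, .refl, hU, hfree⟩
  | cons c U ih =>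
    rw [List.map_cons, List.sum_cons] at hb
    have hle : (joinOneCube q D (σ.budget i : ℕ∞) o c).steps ≤ (joinOneCube q D ⊤ o c).steps :=
      joinOneCube_steps_le
    have hlast : (joinOneCube q D (σ.budget i : ℕ∞) o c).last = c.hi := by
      refine joinOneCube_last.resolve_left fun h => ?_
      have : σ.budget i < (joinOneCube q D (σ.budget i : ℕ∞) o c).steps := by exact_mod_cast h
      omega
    obtain ⟨σ₁, h1, h2, h3, h4⟩ : ∃ σ₁, ThreadStep q D o n σ σ₁ ∧ σ₁.sys.unprocessed = U ∧
        σ₁.budget = σ.budget ∧ σ₁.target = Function.update σ.target i (some c) :=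
      ⟨_, .retrieve σ i c U (by omega) (hfree i) hU, rfl, rfl, rfl⟩
    obtain ⟨σ₂, h5, h6, h7, h8⟩ : ∃ σ₂, ThreadStep q D o n σ₁ σ₂ ∧ σ₂.sys.unprocessed = U ∧
        σ₂.budget = Function.update σ.budget i
          (σ.budget i - (joinOneCube q D (σ.budget i : ℕ∞) o c).steps) ∧
        σ₂.target = Function.update σ₁.target i none :=
      ⟨_, .join σ₁ i c _ (by simp [h4]) rfl, by simp [h2, h3, hlast, remainder_hi],
        by simp only [h3], rfl⟩
    obtain ⟨τ, h9, h10⟩ := ih σ₂ h6 (fun t => by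
      by_cases hti : t = i
      · subst hti; simp [h8]
      · simp [h8, h4, Function.update_of_ne hti, hfree t])
      (by rw [h7, Function.update_self]; omega)
    exact ⟨τ, .head h1 (.head h5 h9), h10⟩

/-- Threads that find no unprocessed cube become idle. -/
theorem exists_idle (s : Finset (Fin n)) (σ : EpisodeState q n) (hU : σ.sys.unprocessed = 0)
    (hfree : ∀ t, σ.target t = none) (hs : ∀ t, σ.budget t ≠ 0 → t ∈ s) :
    ∃ τ, Relation.ReflTransGen (ThreadStep q D o n) σ τ ∧ τ.sys.unprocessed = 0 ∧
      (∀ t, τ.budget t = 0) ∧ ∀ t, τ.target t = none := by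
  induction s using Finset.induction_on generalizing σ with
  | empty => exact ⟨σ, .refl, hU, fun t => by simpa using hs t, hfree⟩
  | insert i s hi ih =>
    by_cases hb : σ.budget i = 0
    · refine ih σ hU hfree fun t ht => ?_
      refine (Finset.mem_insert.1 (hs t ht)).resolve_left ?_
      rintro rfl
      exact ht hb
    · obtain ⟨σ₁, h1, h2, h3, h4⟩ : ∃ σ₁, ThreadStep q D o n σ σ₁ ∧ σ₁.sys.unprocessed = 0 ∧
          σ₁.budget = Function.update σ.budget i 0 ∧ σ₁.target = σ.target :=
        ⟨_, .idle σ i (Nat.pos_of_ne_zero hb) (hfree i) hU, hU, rfl, rfl⟩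
      obtain ⟨τ, h5, h6⟩ := ih σ₁ h2 (by rwa [h4]) fun t ht => by
        rw [h3] at ht
        have hti : t ≠ i := by rintro rfl; simp at ht
        rw [Function.update_of_ne hti] at ht
        exact (Finset.mem_insert.1 (hs t ht)).resolve_left hti
      exact ⟨τ, .head h1 h5, h6⟩

theorem exists_completes (q : JoinQuery) (D : Instance q) (hn : 1 ≤ n) :
    ∃ (os : List (AttrOrder q)) (time : ℕ), Completes q D n os time ∧ os.length ≤ 1 := by
  obtain ⟨a, -, ha⟩ := Finset.exists_max_image Finset.univ
    (fun x => (queryCube q D).hi x - (queryCube q D).lo x) ⟨⟨0, q.numAttr_pos⟩, Finset.mem_univ _⟩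
  set U := initialCubes (queryCube q D) a n with hU
  set o : AttrOrder q := Equiv.refl _
  -- The extra 1 keeps the budget of the working thread positive throughout, so it can retrieve
  -- every cube and never times out.
  set b := (U.map fun c => (joinOneCube q D ⊤ o c).steps).sum + 1 with hb
  have hrun := Run.init (n := n) (b := b) a fun x => ha x (Finset.mem_univ x)
  obtain ⟨ρ, h1, h2, h3⟩ := exists_processed (n := n) D o ⟨0, hn⟩ U
    ⟨⟨U, ∅, n * q.numAttr + q.numAttr ^ 2 + q.numAttr⟩, fun _ => b, fun _ => none⟩ rfl
    (fun _ => rfl) (by simp [hb])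
  obtain ⟨τ, h4, h5, h6, h7⟩ := exists_idle Finset.univ ρ h2 h3 fun t _ => Finset.mem_univ t
  refine ⟨[] ++ [o], τ.sys.time, ⟨b, τ.sys, .episode [] _ τ.sys o hrun ?_ ?_, h5, rfl⟩, by simp⟩
  · simpa using initialCubes_ne_nil (queryCube_isNonempty q D) a hn
  · exact ⟨τ, h1.trans h4, h6, h7, rfl⟩

end Existence

/-! ### Worst-case times -/

section WorstCaseTime

variable {q : JoinQuery} {N : Fin q.numRel → ℕ}

theorem opCost_le_logFactor {D : Instance q} (hD : SizeAtMost q N D) :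
    opCost q D ≤ logFactor q N :=
  Nat.add_le_add_left (Nat.log_mono_right (Finset.sup_mono_fun fun e _ => hD e)) 1

/-- Every database can be enlarged to any given larger relation sizes. -/
theorem exists_enlarged {D : Instance q} (hD : SizeAtMost q N D) :
    ∃ D' : Instance q, SizeAtMost q N D' ∧ joinResult q D ⊆ joinResult q D' ∧
      opCost q D' = logFactor q N := by
  -- Every relation has at least one attribute, so there are enough integer tuples to pad it.
  have hinf : ∀ e, Infinite ((x : Fin q.numAttr) → x ∈ q.attrs e → ℤ) := by
    intro e
    obtain ⟨x, hx⟩ := q.attrs_nonempty e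
    exact Infinite.of_injective (fun z _ _ => z) fun z z' h => congrFun (congrFun h x) hx
  choose D' h1 h2 using fun e =>
    haveI := hinf e
    Infinite.exists_superset_card_eq (D e) (N e) (hD e)
  exact ⟨D', fun e => (h2 e).le, fun t ht e => h1 e (ht e), by simp only [opCost, h2]⟩

/-- A time that is at least the cost of the result is, in the worst case, at least the cost of the
largest result. -/
theorem worstCaseOutput_mul_logFactor_le {T : Instance q → ℕ∞}
    (hT : ∀ D, (joinResult q D).encard * (opCost q D : ℕ∞) ≤ T D) :
    worstCaseOutput q N * logFactor q N ≤ ⨆ (D : Instance q) (_ : SizeAtMost q N D), T D := by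
  rw [worstCaseOutput]
  simp only [ENat.iSup_mul]
  refine iSup₂_le fun D hD => ?_
  obtain ⟨D', h1, h2, h3⟩ := exists_enlarged hD
  refine le_iSup₂_of_le D' h1 (le_trans ?_ (hT D'))
  rw [h3]
  gcongr

/-- The factor between the time of LFTJ and the worst-case output size, up to the logarithm. -/
def lftjFactor (q : JoinQuery) : ℕ :=
  (q.numAttr + 1) * (3 * q.numRel + 3 * (q.numRel + 1) ^ 2 + q.numAttr)

theorem lftjTime_le {D : Instance q} (hN : ∀ e, 1 ≤ N e) (hD : SizeAtMost q N D)
    (o : AttrOrder q) :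
    (lftjTime q D o : ℕ∞) ≤ lftjFactor q * (worstCaseOutput q N * logFactor q N) := by
  cases hQ : worstCaseOutput q N using ENat.recTopCoe with
  -- Finiteness of the largest output is not needed: in this case the right-hand side is infinite
  -- too, because both factors are nonzero.
  | top =>
    have h1 : (lftjFactor q : ℕ∞) ≠ 0 := by
      rw [lftjFactor]
      exact_mod_cast (by positivity)
    have h2 : (logFactor q N : ℕ∞) ≠ 0 := by
      rw [logFactor]
      exact_mod_cast (by positivity)
    rw [ENat.top_mul h2, ENat.mul_top h1]
    exact le_top
  | coe Q =>
    have h1 := lftjTime_le_worstCaseOutput hN hD o hQ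
    have h2 : lftjTime q D o ≤ lftjFactor q * (Q * logFactor q N) :=
      h1.trans (Nat.mul_le_mul_left _ (Nat.mul_le_mul_left _ (opCost_le_logFactor hD)))
    exact_mod_cast h2

end WorstCaseTime

end Adopt

open Adopt
theorem mainTheorem1 (q : JoinQuery) (n E : ℕ) (hn : 1 ≤ n) (hE : 1 ≤ E) :
    ∃ C : ℕ,
      -- every complete join phase with at most `E` episodes is within a constant factor of the
      -- LFTJ time on the same database, for one of the attribute orders that it used
      (∀ (D : Instance q) (os : List (AttrOrder q)) (time : ℕ),
        Completes q D n os time → os.length ≤ E → ∃ o ∈ os, time ≤ C * lftjTime q D o) ∧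
      -- such join phases exist
      (∀ D : Instance q, ∃ (os : List (AttrOrder q)) (time : ℕ),
        Completes q D n os time ∧ os.length ≤ E) ∧
      ∀ N : Fin q.numRel → ℕ, (∀ e, 1 ≤ N e) →
        -- worst-case running times of ADOPT and LFTJ are equal up to constant factors, whatever
        -- attribute order LFTJ uses and whatever choices ADOPT makes
        (∀ o : AttrOrder q,
          adoptWorstTime q N n E ≤ C * lftjWorstTime q N o ∧
          lftjWorstTime q N o ≤ C * adoptWorstFastestTime q N n E) ∧
        -- worst-case optimality
        (∀ D : Instance q, SizeAtMost q N D →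
          adoptSlowest q D n E ≤ C * (worstCaseOutput q N * logFactor q N)) := by
  have h1 : adoptFactor q n E ≤ adoptFactor q n E * lftjFactor q := by
    refine Nat.le_mul_of_pos_right _ ?_
    rw [lftjFactor]; positivity
  have hslow : ∀ N : Fin q.numRel → ℕ, (∀ e, 1 ≤ N e) → ∀ D : Instance q, SizeAtMost q N D →
      adoptSlowest q D n E ≤ ((adoptFactor q n E * lftjFactor q + lftjFactor q : ℕ) : ℕ∞) *
        (worstCaseOutput q N * logFactor q N) := by
    intro N hN D hD
    refine iSup_le fun os => iSup₂_le fun time h => ?_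
    obtain ⟨o, -, ho⟩ := h.1.exists_time_le hn h.2
    calc (time : ℕ∞) ≤ (adoptFactor q n E : ℕ∞) * (lftjTime q D o : ℕ∞) := by exact_mod_cast ho
      _ ≤ (adoptFactor q n E : ℕ∞) *
          (lftjFactor q * (worstCaseOutput q N * logFactor q N)) := by
          gcongr
          exact lftjTime_le hN hD o
      _ = ((adoptFactor q n E * lftjFactor q : ℕ) : ℕ∞) *
          (worstCaseOutput q N * logFactor q N) := by
          rw [← mul_assoc]; push_cast; rfl
      _ ≤ _ := by
          gcongr
          exact Nat.le_add_right _ _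
  -- The first summand bounds ADOPT by the worst-case output, and also by LFTJ on the same database;
  -- the second bounds LFTJ by the worst-case output.
  refine ⟨adoptFactor q n E * lftjFactor q + lftjFactor q, fun D os time h hos => ?_,
    fun D => ?_, fun N hN => ⟨fun o => ⟨?_, ?_⟩, hslow N hN⟩⟩
  · obtain ⟨o, ho, h2⟩ := h.exists_time_le hn hos
    exact ⟨o, ho, h2.trans (Nat.mul_le_mul_right _ (h1.trans (Nat.le_add_right _ _)))⟩
  · obtain ⟨os, time, h, hos⟩ := exists_completes q D hn
    exact ⟨os, time, h, hos.trans hE⟩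
  -- The two worst cases are compared through the worst-case output: one is at most a multiple of
  -- it, the other at least it, each with the logarithmic factor. The databases attaining them need
  -- not be related.
  · refine iSup₂_le fun D hD => (hslow N hN D hD).trans ?_
    gcongr
    exact worstCaseOutput_mul_logFactor_le fun D =>
      encard_joinResult_mul_opCost_le_lftjTime q D o
  · refine iSup₂_le fun D hD => (lftjTime_le hN hD o).trans ?_
    gcongr
    · exact Nat.le_add_left _ _
    · exact worstCaseOutput_mul_logFactor_le fun D => le_iInf fun os => le_iInf₂ fun time h =>
        h.1.encard_joinResult_mul_opCost_le hn
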